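/- **Setting.** Let $D$ be an oriented link diagram of a link $L$, with $n_+$ positive and $n_-$ negative crossings. Its enhanced states are the complete smoothings $s$ of $D$ together with a label $1$ or $x$ on each circle. Let $|s|$ be the number of $1$-smoothings of $s$. An enhanced state has homological grading $|s|-n_-$ and $q$-grading $\#\{\text{labels }1\}-\#\{\text{labels }x\}+|s|+n_+-2n_-$. The mod 2 Khovanov complex $(\overline C^{*,*}(D),\partial)$ has the enhanced states as an $\mathbb F_2$-basis. Its differential $\partial$ is the sum, over the edges of the cube of smoothings, of the maps obtained by merging two circles with $\overline m$ or splitting a circle with $\overline\Delta$, where $$\overline m(1,1)=1,\quad \overline m(1,x)=\overline m(x,1)=x,\quad \overline m(x,x)=0,\qquad \overline\Delta(1)=1\otimes x+x\otimes 1,\quad \overline\Delta(x)=x\otimes x.$$ Its homology is denoted $Kh^{*,*}(L)$. In the same way the maps $\tilde m(x,x)=x$, $\tilde m(1,1)=\tilde m(1,x)=\tilde m(x,1)=0$, $\tilde\Delta(1)=1\otimes 1$, $\tilde\Delta(x)=0$ define a chain map $\beta$ on this complex. It induces $\beta_*\colon Kh^{i,j}(L)\to Kh^{i+1,j+2}(L)$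 with $\beta_*^2=0$. Put $$\mathcal K^{i,j}(L)=\frac{\ker(\beta_*\colon Kh^{i,j}(L)\to Kh^{i+1,j+2}(L))}{\operatorname{im}(\beta_*\colon Kh^{i-1,j-2}(L)\to Kh^{i,j}(L))}.$$ The Bar-Natan complex $(C^{*,*}(D),d)$ is free over $\mathbb F_2[u]$ on the enhanced states, where $u$ has bidegree $(0,-2)$. Its differential $d$ is defined in the same way from $m=\overline m+u\tilde m$ and $\Delta=\overline\Delta+u\tilde\Delta$. Its homology is graded Bar-Natan homology $BN^{*,*}(L)$. **Theorem.** Fix $j\in\mathbb Z$. Filter $C^{*,j}(D)$ by $F^kC^{*,j}=u^kC^{*,*}\cap C^{*,j}$ for $k\ge 0$, and $F^kC^{*,j}=C^{*,j}$ for $k<0$. The cohomological spectral sequence $(E_r^{k,l},d_r)$, with $d_r\colon E_r^{k,l}\to E_r^{k+r,l+1-r}$, of this filtered complex has the following properties. 1. It converges to $BN^{*,j}(L)$. Let $F^kBN^{i,j}(L)=\operatorname{im}(H^i(F^kC^{*,j})\to H^i(C^{*,j}))$. This filtration equals $BN^{i,j}(L)$ for $k\le 0$ and vanishes for $k$ large,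 uniformly in $i$. There is an $R$ such that for all $r\ge R$ every differential $d_r$ is zero and, for all $k,l$, the natural map identifies $$E_r^{k,l}\cong F^kBN^{k+l,j}(L)/F^{k+1}BN^{k+l,j}(L)=:E_\infty^{k,l}.$$ Moreover $BN^{i,j}(L)\cong\bigoplus_{k+l=i}E_\infty^{k,l}$ for every $i$. 2. $E_1^{k,l}=0$ for $k<0$. For $k\ge 0$ there is an isomorphism $E_1^{k,l}\cong Kh^{k+l,\,j+2k}(L)$ which sends the class of $u^kz$ to the class of $z$ for every cocycle $z\in\overline C^{k+l,\,j+2k}(D)$. 3. Under these isomorphisms $d_1\colon E_1^{k,l}\to E_1^{k+1,l}$ is $\beta_*\colon Kh^{k+l,\,j+2k}(L)\to Kh^{k+l+1,\,j+2k+2}(L)$ for $k\ge 0$. 4. The isomorphisms of (2) induce $$E_2^{k,l}\cong\begin{cases}\mathcal K^{k+l,\,j+2k}(L)& k>0,\\ \ker(\beta_*\colon Kh^{l,j}(L)\to Kh^{l+1,j+2}(L))& k=0,\\ 0&k<0.\end{cases}$$ -/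

import Mathlib

/-- The basis `{1, x}` of the Frobenius algebra `A`. -/
inductive Label
  | one
  | x
  deriving DecidableEq

instance : Fintype Label := ⟨{Label.one, Label.x}, by rintro ⟨⟩ <;> simp⟩

/-- A half-edge of a diagram with `n` crossings is a pair `(c, p)`: the end at position `p` of the
crossing `c`. Positions are numbered counterclockwise, and position `0` is the incoming end of the
under-strand. Hence `2` is the outgoing end of the under-strand and `1`, `3` are the ends of the
over-strand. -/
abbrev HalfEdge (n : ℕ) : Type := Fin n × Fin 4

/-- The half-edge next to `h` counterclockwise around its crossing. -/
def HalfEdge.rot {n : ℕ} (h : HalfEdge n) : HalfEdge n := (h.1, h.2 + 1)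

/-- Whether the orientation of the link points away from the crossing along `h`. The over-strand
runs from position `3` to position `1` at a positive crossing, and from `1` to `3` at a negative
one. -/
def HalfEdge.isOut {n : ℕ} (positive : Fin n → Bool) (h : HalfEdge n) : Bool :=
  ![false, positive h.1, true, !(positive h.1)] h.2

/-- Oriented link diagrams in the plane (or the sphere), in the form of planar diagram codes:
finitely many crossings, whose ends are joined in pairs by the edges of the diagram, and finitely
many components without crossings. -/
structure LinkDiagram where
  /-- the number of crossings -/
  crossings : ℕ
  /-- the number of embedded circles of the diagram which pass through no crossing -/
  loops : ℕ
  /-- the signs of the crossings -/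
  positive : Fin crossings → Bool
  /-- the other end of the edge of the diagram which starts at a half-edge -/
  opp : HalfEdge crossings → HalfEdge crossings
  opp_opp : ∀ h, opp (opp h) = h
  /-- every edge is oriented: it leaves a crossing at one end and enters a crossing at the other -/
  isOut_opp : ∀ h, HalfEdge.isOut positive (opp h) = !(HalfEdge.isOut positive h)
  /-- The diagram is planar: every connected component of the underlying four-valent graph, with
  the given cyclic orders at its vertices, has genus zero. In other words `V - E + F = 2 C`, where
  there are `V = crossings` vertices, `E = 2 * crossings` edges, `F` faces (the orbits of
  `rot ∘ opp`) and `C` connected components. -/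
  planar : Nat.card (Quot fun h h' : HalfEdge crossings => h' = (opp h).rot) =
    crossings + 2 * Nat.card (Quot fun h h' : HalfEdge crossings => h' = opp h ∨ h' = h.rot)

namespace LinkDiagram

variable (D : LinkDiagram)

/-- A complete smoothing: every crossing is replaced by its `0`-smoothing (`false`) or its
`1`-smoothing (`true`). -/
abbrev Smoothing : Type := Fin D.crossings → Bool

variable {D}

/-- The half-edge joined to `h` inside the crossing by the smoothing `s`. The `0`-smoothing joins
the positions `0, 1` and `2, 3`; the `1`-smoothing joins the positions `0, 3` and `1, 2`. (So the
`0`-smoothing joins the two regions swept out by rotating the over-strand counterclockwise.) -/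
def arc (s : D.Smoothing) (h : HalfEdge D.crossings) : HalfEdge D.crossings :=
  (h.1, if s h.1 then ![3, 2, 1, 0] h.2 else ![1, 0, 3, 2] h.2)

/-- Two half-edges are adjacent in the smoothing `s` if they are the ends of an edge of the diagram
or of one of the two arcs replacing a crossing. -/
def Adj (s : D.Smoothing) (h h' : HalfEdge D.crossings) : Prop := h' = D.opp h ∨ h' = arc s h

/-- The circles of a complete smoothing. -/
abbrev Circle (s : D.Smoothing) : Type := Quot (Adj s) ⊕ Fin D.loops

/-- The circle of the smoothing `s` which contains the half-edge `h`. -/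
def circleOf (s : D.Smoothing) (h : HalfEdge D.crossings) : Circle s := Sum.inl (Quot.mk _ h)

noncomputable instance (s : D.Smoothing) : Fintype (Circle s) := Fintype.ofFinite _

noncomputable instance (s : D.Smoothing) : DecidableEq (Circle s) := Classical.decEq _

/-! ### Planarity: an edge of the cube of smoothings merges two circles or splits one -/

lemma arc_arc (s : D.Smoothing) (h : HalfEdge D.crossings) : arc s (arc s h) = h := by
  obtain ⟨c, p⟩ := h
  simp only [arc]
  cases s c <;> fin_cases p <;> rfl

/-- functions constant on the classes of a relation -/
def inv {H : Type} (r : H → H → Prop) : Submodule (ZMod 2) (H → ZMod 2) where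
  carrier := {f | ∀ h h', r h h' → f h = f h'}
  add_mem' hf hg h h' hr := by simp [hf h h' hr, hg h h' hr]
  zero_mem' _ _ _ := rfl
  smul_mem' a f hf h h' hr := by simp [hf h h' hr]

noncomputable def invEquiv {H : Type} (r : H → H → Prop) :
    inv r ≃ₗ[ZMod 2] (Quot r → ZMod 2) where
  toFun f := Quot.lift f.1 f.2
  map_add' f g := by ext q; induction q using Quot.ind; rfl
  map_smul' f g := by ext q; induction q using Quot.ind; rfl
  invFun g := ⟨fun h => g (Quot.mk _ h), fun h h' hr => congrArg g (Quot.sound hr)⟩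
  left_inv f := rfl
  right_inv g := by ext q; induction q using Quot.ind; rfl

lemma finrank_inv {H : Type} [Finite H] (r : H → H → Prop) :
    Module.finrank (ZMod 2) (inv r) = Nat.card (Quot r) := by
  have := Fintype.ofFinite (Quot r)
  rw [(invEquiv r).finrank_eq, Module.finrank_fintype_fun_eq_card, Nat.card_eq_fintype_card]

set_option maxHeartbeats 1000000 in
/-- In a planar diagram the half-edges carry an alternating `2`-colouring (a source-sink
structure, coming from a checkerboard colouring of the faces). -/
lemma exists_alternating (D : LinkDiagram) : ∃ f : HalfEdge D.crossings → ZMod 2,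
    (∀ h, f (D.opp h) = f h + 1) ∧ ∀ h, f h.rot = f h + 1 := by
  classical
  let rF : HalfEdge D.crossings → HalfEdge D.crossings → Prop := fun h h' => h' = (D.opp h).rot
  let rC : HalfEdge D.crossings → HalfEdge D.crossings → Prop := fun h h' => h' = D.opp h ∨ h' = h.rot
  let rE : HalfEdge D.crossings → HalfEdge D.crossings → Prop := fun h h' => h' = D.opp h
  let A : (HalfEdge D.crossings → ZMod 2) →ₗ[ZMod 2] (HalfEdge D.crossings → ZMod 2) := LinearMap.id + LinearMap.funLeft _ _ D.opp
  let B : (HalfEdge D.crossings → ZMod 2) →ₗ[ZMod 2] (Fin D.crossings → ZMod 2) :=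
    LinearMap.pi fun c => ∑ p : Fin 4, LinearMap.proj (c, p)
  have hA : ∀ f h, A f h = f h + f (D.opp h) := fun f h => rfl
  have hB : ∀ f c, B f c = f (c, 0) + f (c, 1) + f (c, 2) + f (c, 3) := fun f c => by
    simp only [B, LinearMap.pi_apply, Fin.sum_univ_four, LinearMap.add_apply]
    rfl
  have two : ∀ a b : ZMod 2, a + b = 0 → a = b := by decide
  -- a face-invariant function has f (opp h) = f (rot h)
  have hface : ∀ f ∈ inv rF, ∀ h, f (D.opp h) = f h.rot := fun f hf h => by
    have := hf (D.opp h) h.rot (by simp [rF, D.opp_opp])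
    exact this
  -- kernel of A on inv rF
  have h1 : Module.finrank (ZMod 2) ((inv rF).map A) + Nat.card (Quot rC) = Nat.card (Quot rF) := by
    rw [← finrank_inv rF, ← finrank_inv rC]
    have := LinearMap.finrank_range_add_finrank_ker (A.domRestrict (inv rF))
    rw [← this, LinearMap.range_domRestrict]
    congr 1
    have hle : inv rC ≤ inv rF := by
      intro f hf h h' hr
      rw [hf h (D.opp h) (Or.inl rfl), hf (D.opp h) h' (Or.inr hr)]
    have : LinearMap.ker (A.domRestrict (inv rF)) = (inv rC).submoduleOf (inv rF) := by
      ext ⟨f, hf⟩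
      change A f = 0 ↔ f ∈ inv rC
      constructor
      · intro h0
        have e1 : ∀ h, f h = f (D.opp h) := fun h => two _ _ (by rw [← hA, h0]; rfl)
        rintro h h' (rfl | rfl)
        · exact e1 h
        · exact (e1 h).trans (hface f hf h)
      · intro h0
        ext h
        rw [hA, ← h0 h (D.opp h) (Or.inl rfl)]
        exact CharTwo.add_self_eq_zero _
    rw [this]
    exact (Submodule.submoduleOfEquivOfLe hle).finrank_eq.symm
  -- edge functions
  have h2 : Module.finrank (ZMod 2) (inv rE) ≤ 2 * D.crossings := by
    let R : inv rE →ₗ[ZMod 2] (Fin D.crossings × Bool → ZMod 2) :=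
      (LinearMap.funLeft (ZMod 2) (ZMod 2) (fun x : Fin D.crossings × Bool =>
        ((x.1, if x.2 then 2 else if D.positive x.1 then 1 else 3) : HalfEdge D.crossings))).domRestrict (inv rE)
    have hR : Function.Injective R := by
      rw [injective_iff_map_eq_zero]
      rintro ⟨f, hf⟩ h0
      have hout : ∀ h : HalfEdge D.crossings, HalfEdge.isOut D.positive h = true → f h = 0 := by
        rintro ⟨c, p⟩ hp
        have a1 := congrFun h0 (c, true)
        have a2 := congrFun h0 (c, false)
        simp only [R, LinearMap.domRestrict_apply, LinearMap.funLeft_apply, Pi.zero_apply] at a1 a2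
        have hp' : ![false, D.positive c, true, !(D.positive c)] p = true := hp
        fin_cases p
        · exact absurd hp' (by simp)
        · have : D.positive c = true := hp'
          simpa [this] using a2
        · simpa using a1
        · have : D.positive c = false := by simpa using hp'
          simpa [this] using a2
      ext h
      by_cases hh : HalfEdge.isOut D.positive h = true
      · exact hout h hh
      · have := hf h (D.opp h) rfl
        change f h = 0
        rw [this]
        exact hout _ (by rw [D.isOut_opp]; simpa using hh)
    have := LinearMap.finrank_le_finrank_of_injective hR
    simpa [mul_comm] using this
  -- rank of B
  have h3 : D.crossings ≤ Module.finrank (ZMod 2) ((inv rE).map B) + Nat.card (Quot rC) := by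
    have e := Subspace.finrank_add_finrank_dualAnnihilator_eq ((inv rE).map B)
    rw [Module.finrank_fin_fun] at e
    refine e.symm.le.trans ?_
    rw [← finrank_inv rC]
    gcongr
    let T : ((inv rE).map B).dualAnnihilator →ₗ[ZMod 2] (HalfEdge D.crossings → ZMod 2) :=
      { toFun := fun g h => g.1 (Pi.single h.1 1)
        map_add' := fun _ _ => rfl
        map_smul' := fun _ _ => rfl }
    have hT : ∀ g, T g ∈ inv rC := by
      rintro ⟨g, hg⟩ h h' (rfl | rfl)
      · rw [Submodule.mem_dualAnnihilator] at hg
        have key : B (Pi.single h 1 + Pi.single (D.opp h) 1) =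
            Pi.single h.1 1 + Pi.single (D.opp h).1 1 := by
          have : ∀ h : HalfEdge D.crossings, B (Pi.single h 1) = Pi.single h.1 1 := by
            rintro ⟨c, p⟩
            ext c'
            rw [hB]
            by_cases hc : c' = c
            · subst hc
              fin_cases p <;> simp [Prod.mk.injEq]
            · simp [Prod.mk.injEq, hc]
          rw [map_add, this, this]
        have := hg _ ⟨_, ?_, key⟩
        · rw [map_add] at this
          exact two _ _ this
        · rintro a b rfl
          simp only [Pi.add_apply, Pi.single_apply]
          have i1 : D.opp a = h ↔ a = D.opp h := ⟨fun h => by rw [← h, D.opp_opp], fun h => by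
            rw [h, D.opp_opp]⟩
          have i2 : D.opp a = D.opp h ↔ a = h := ⟨fun h => by
            rw [← D.opp_opp a, h, D.opp_opp], fun h => by rw [h]⟩
          simp only [i1, i2]
          rw [add_comm]
      · rfl
    have hTi : Function.Injective (T.codRestrict (inv rC) hT) := by
      intro g g' hgg
      apply Subtype.ext
      by_cases hn : ∃ _ : Fin D.crossings, True
      · refine LinearMap.pi_ext' fun c => ?_
        ext
        exact congrFun (congrArg Subtype.val hgg) (c, 0)
      · have : IsEmpty (Fin D.crossings) := ⟨fun c => hn ⟨c, trivial⟩⟩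
        exact Subsingleton.elim _ _
    exact LinearMap.finrank_le_finrank_of_injective hTi
  -- kernel of B
  have h4 : Module.finrank (ZMod 2) ((inv rE ⊓ LinearMap.ker B : Submodule (ZMod 2) (HalfEdge D.crossings → ZMod 2))) +
      Module.finrank (ZMod 2) ((inv rE).map B) = Module.finrank (ZMod 2) (inv rE) := by
    have := LinearMap.finrank_range_add_finrank_ker (B.domRestrict (inv rE))
    rw [← this, LinearMap.range_domRestrict, add_comm]
    congr 1
    have : LinearMap.ker (B.domRestrict (inv rE)) =
        (inv rE ⊓ LinearMap.ker B).submoduleOf (inv rE) := by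
      ext ⟨f, hf⟩
      change B f = 0 ↔ f ∈ inv rE ∧ B f = 0
      exact ⟨fun h => ⟨hf, h⟩, fun h => h.2⟩
    rw [this]
    exact (Submodule.submoduleOfEquivOfLe inf_le_left).finrank_eq.symm
  have hle : (inv rF).map A ≤ inv rE ⊓ LinearMap.ker B := by
    rintro _ ⟨f, hf, rfl⟩
    refine ⟨?_, ?_⟩
    · rintro h h' rfl
      rw [hA, hA, D.opp_opp, add_comm]
    · change B (A f) = 0
      ext c
      rw [hB]
      simp only [hA, hface f hf]
      have e0 : HalfEdge.rot ((c, 0) : HalfEdge D.crossings) = (c, 1) := rfl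
      have e1 : HalfEdge.rot ((c, 1) : HalfEdge D.crossings) = (c, 2) := rfl
      have e2 : HalfEdge.rot ((c, 2) : HalfEdge D.crossings) = (c, 3) := rfl
      have e3 : HalfEdge.rot ((c, 3) : HalfEdge D.crossings) = (c, 0) := rfl
      rw [e0, e1, e2, e3, Pi.zero_apply]
      generalize f (c, 0) = a0
      generalize f (c, 1) = a1
      generalize f (c, 2) = a2
      generalize f (c, 3) = a3
      revert a0 a1 a2 a3
      decide
  have hpl : Nat.card (Quot rF) = D.crossings + 2 * Nat.card (Quot rC) := D.planar
  have heq : (inv rF).map A = inv rE ⊓ LinearMap.ker B :=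
    Submodule.eq_of_le_of_finrank_le hle (by omega)
  have hone : (fun _ => 1 : (HalfEdge D.crossings → ZMod 2)) ∈ inv rE ⊓ LinearMap.ker B := by
    refine ⟨fun _ _ _ => rfl, ?_⟩
    change B (fun _ => 1) = 0
    ext c
    rw [hB]
    rfl
  rw [← heq] at hone
  obtain ⟨f, hf, hf1⟩ := hone
  have e1 : ∀ h, f (D.opp h) = f h + 1 := fun h => by
    have : f h + f (D.opp h) = 1 := by rw [← hA, hf1]
    generalize f h = a at *
    generalize f (D.opp h) = b at *
    revert a b
    decide
  exact ⟨f, e1, fun h => by rw [← hface f hf, e1]⟩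

/-- Multiplying a permutation by the transposition of `p` and `q` joins or separates their cycles. -/
lemma sameCycle_mul_swap {X : Type} [Finite X] [DecidableEq X] (σ : Equiv.Perm X) {p q : X}
    (hpq : p ≠ q) :
    (σ * Equiv.swap p q).SameCycle p q ↔ ¬ σ.SameCycle p q := by
  -- if `p, q` lie on different cycles then the product joins them
  have join : ∀ τ : Equiv.Perm X, ¬ τ.SameCycle p q → (τ * Equiv.swap p q).SameCycle p q := by
    intro τ h
    set τ' := τ * Equiv.swap p q with hτ'
    have hp : τ' p = τ q := by simp [hτ']
    have key : ∀ m : ℕ, (∀ i, 0 < i → i < m → (τ ^ i) q ≠ q) → 0 < m →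
        (τ' ^ m) p = (τ ^ m) q := by
      intro m
      induction m with
      | zero => intro _ h0; omega
      | succ m ih =>
        intro hm _
        rcases Nat.eq_zero_or_pos m with rfl | hm0
        · simpa using hp
        · rw [pow_succ', pow_succ', Equiv.Perm.mul_apply, Equiv.Perm.mul_apply,
            ih (fun i h1 h2 => hm i h1 (by omega)) hm0]
          have n1 : (τ ^ m) q ≠ q := hm m hm0 (by omega)
          have n2 : (τ ^ m) q ≠ p := fun e =>
            h ((Equiv.Perm.SameCycle.symm ⟨(m : ℤ), by simpa using e⟩))
          rw [Equiv.swap_apply_of_ne_of_ne n2 n1, Equiv.Perm.mul_apply]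
    have hex : ∃ m, 0 < m ∧ (τ ^ m) q = q := ⟨orderOf τ, orderOf_pos τ, by simp [pow_orderOf_eq_one]⟩
    classical
    have := Nat.find_spec hex
    refine ⟨(Nat.find hex : ℤ), ?_⟩
    rw [zpow_natCast, key _ (fun i h1 h2 e => Nat.find_min hex h2 ⟨h1, e⟩) this.1, this.2]
  refine ⟨fun h1 h2 => ?_, join σ⟩
  -- if `p, q` lie on one cycle of `σ`, they are separated
  have hex : ∃ m, 0 < m ∧ (σ ^ m) p = q := by
    obtain ⟨m, hm, -, h⟩ := h2.exists_pow_eq''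
    exact ⟨m, hm, h⟩
  classical
  set m := Nat.find hex with hm
  obtain ⟨hm0, hmq⟩ := Nat.find_spec hex
  -- the powers of the product starting at `q` stay among `σ p, ..., σ ^ m p`
  set τ := σ * Equiv.swap p q with hτ
  have stay : ∀ i : ℕ, ∃ t, 0 < t ∧ t ≤ m ∧ (τ ^ i) q = (σ ^ t) p := by
    intro i
    induction i with
    | zero => exact ⟨m, hm0, le_rfl, by simpa using hmq.symm⟩
    | succ i ih =>
      obtain ⟨t, t0, tm, ht⟩ := ih
      rw [pow_succ', Equiv.Perm.mul_apply, ht]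
      rcases tm.lt_or_eq with hlt | heq
      · refine ⟨t + 1, by omega, by omega, ?_⟩
        have n1 : (σ ^ t) p ≠ q := fun e => Nat.find_min hex hlt ⟨t0, e⟩
        have n2 : (σ ^ t) p ≠ p := fun e => by
          refine Nat.find_min hex (m := m - t) (by omega) ⟨by omega, ?_⟩
          have : (σ ^ (m - t + t)) p = q := by rw [Nat.sub_add_cancel tm]; exact hmq
          rwa [pow_add, Equiv.Perm.mul_apply, e] at this
        rw [hτ, Equiv.Perm.mul_apply, Equiv.swap_apply_of_ne_of_ne n2 n1, pow_succ',
          Equiv.Perm.mul_apply]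
      · refine ⟨1, one_pos, hm0, ?_⟩
        rw [heq, hmq, hτ]
        simp
  obtain ⟨i, -, -, hi⟩ := h1.symm.exists_pow_eq''
  obtain ⟨t, t0, tm, ht⟩ := stay i
  rw [hi] at ht
  rcases tm.lt_or_eq with hlt | heq
  · refine Nat.find_min hex (m := m - t) (by omega) ⟨by omega, ?_⟩
    have : (σ ^ (m - t + t)) p = q := by rw [Nat.sub_add_cancel tm]; exact hmq
    rwa [pow_add, Equiv.Perm.mul_apply, ← ht] at this
  · exact hpq (by rw [ht, heq, hmq])

/-- Changing the smoothing of one crossing of a planar diagram merges two circles or splits one. -/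
lemma merge_xor_split (s : D.Smoothing) (c : Fin D.crossings) (hs : s c = false) :
    circleOf (Function.update s c true) (c, 0) = circleOf (Function.update s c true) (c, 2) ↔
      ¬ circleOf s (c, 0) = circleOf s (c, 2) := by
  classical
  obtain ⟨f, hopp, hrot⟩ := D.exists_alternating
  have two : ∀ a : ZMod 2, a + 1 + 1 = a := by decide
  have harc : ∀ (s : D.Smoothing) h, f (arc s h) = f h + 1 := by
    rintro s ⟨c, p⟩
    have h1 : f (c, 1) = f (c, 0) + 1 := hrot (c, 0)
    have h2 : f (c, 2) = f (c, 1) + 1 := hrot (c, 1)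
    have h3 : f (c, 3) = f (c, 2) + 1 := hrot (c, 2)
    simp only [arc]
    cases s c <;> fin_cases p <;> simp [h1, h2, h3, two]
  let X := {h : HalfEdge D.crossings // f h = f (c, 0)}
  -- the circles as cycles of a permutation
  let perm : D.Smoothing → Equiv.Perm X := fun s =>
    { toFun := fun h => ⟨D.opp (arc s h.1), by rw [hopp, harc, two, h.2]⟩
      invFun := fun h => ⟨arc s (D.opp h.1), by rw [harc, hopp, two, h.2]⟩
      left_inv := fun h => Subtype.ext (by simp [D.opp_opp, arc_arc])
      right_inv := fun h => Subtype.ext (by simp [D.opp_opp, arc_arc]) }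
  have hf2 : f (c, 2) = f (c, 0) := by
    rw [show ((c, 2) : HalfEdge D.crossings) = HalfEdge.rot (HalfEdge.rot (c, 0)) from rfl,
      hrot, hrot, two]
  let p : X := ⟨(c, 0), rfl⟩
  let q : X := ⟨(c, 2), hf2⟩
  have hne : p ≠ q := fun e => by simpa [p, q] using congrArg (fun z : X => z.1.2) e
  have hcirc : ∀ (s : D.Smoothing) (a b : X),
      circleOf s a.1 = circleOf s b.1 ↔ (perm s).SameCycle a b := by
    intro s a b
    constructor
    · intro h
      have h' : (Quot.mk _ a.1 : Quot (Adj s)) = Quot.mk _ b.1 := Sum.inl.inj h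
      have ne1 : ∀ a b : ZMod 2, a ≠ b → a + 1 = b := by decide
      let φ : HalfEdge D.crossings → Quotient (Equiv.Perm.SameCycle.setoid (perm s)) := fun h =>
        if hh : f h = f (c, 0) then Quotient.mk _ (⟨h, hh⟩ : X)
        else Quotient.mk _ (⟨arc s h, by rw [harc]; exact ne1 _ _ hh⟩ : X)
      have hφ : ∀ h h', Adj s h h' → φ h = φ h' := by
        have ne2 : ∀ a b : ZMod 2, a = b → ¬ a + 1 = b := by decide
        rintro h h' (rfl | rfl)
        · by_cases hh : f h = f (c, 0)
          · have hh' : ¬ f (D.opp h) = f (c, 0) := by rw [hopp]; exact ne2 _ _ hh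
            simp only [φ, dif_pos hh, dif_neg hh']
            refine Quotient.sound (Equiv.Perm.SameCycle.symm ⟨1, Subtype.ext ?_⟩)
            simp [perm, arc_arc, D.opp_opp]
          · have hh' : f (D.opp h) = f (c, 0) := by rw [hopp]; exact ne1 _ _ hh
            simp only [φ, dif_neg hh, dif_pos hh']
            refine Quotient.sound ⟨1, Subtype.ext ?_⟩
            simp [perm, arc_arc]
        · by_cases hh : f h = f (c, 0)
          · have hh' : ¬ f (arc s h) = f (c, 0) := by rw [harc]; exact ne2 _ _ hh
            simp only [φ, dif_pos hh, dif_neg hh', arc_arc]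
          · have hh' : f (arc s h) = f (c, 0) := by rw [harc]; exact ne1 _ _ hh
            simp only [φ, dif_neg hh, dif_pos hh']
      have := congrArg (Quot.lift φ hφ) h'
      simp only [φ, dif_pos a.2, dif_pos b.2] at this
      exact Quotient.exact this
    · intro h
      obtain ⟨i, -, -, rfl⟩ := h.exists_pow_eq''
      clear h
      have step : ∀ z : X, circleOf s z.1 = circleOf s ((perm s) z).1 := fun z =>
        congrArg Sum.inl ((Quot.sound (r := Adj s) (Or.inr rfl)).trans
          (Quot.sound (r := Adj s) (Or.inl rfl)))
      induction i with
      | zero => rfl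
      | succ i ih => rw [pow_succ', Equiv.Perm.mul_apply, ← step, ← ih]
  have hmul : perm (Function.update s c true) = perm s * Equiv.swap p q := by
    ext1 ⟨⟨c', k⟩, hk⟩
    apply Subtype.ext
    change D.opp _ = D.opp _
    congr 1
    by_cases hc : c' = c
    · subst hc
      have h1 : f (c', 1) = f (c', 0) + 1 := hrot (c', 0)
      have h3 : f (c', 3) = f (c', 2) + 1 := hrot (c', 2)
      have ne2 : ∀ a : ZMod 2, ¬ a + 1 = a := by decide
      fin_cases k
      · have : (⟨(c', 0), hk⟩ : X) = p := rfl
        simp [this, p, q, arc, hs]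
      · exact absurd (h1.symm.trans hk) (ne2 _)
      · have : (⟨(c', 2), hk⟩ : X) = q := rfl
        simp [this, p, q, arc, hs]
      · rw [hf2] at h3
        exact absurd (h3.symm.trans hk) (ne2 _)
    · have n1 : (⟨(c', k), hk⟩ : X) ≠ p := fun e => hc (congrArg (fun z : X => z.1.1) e)
      have n2 : (⟨(c', k), hk⟩ : X) ≠ q := fun e => hc (congrArg (fun z : X => z.1.1) e)
      rw [Equiv.swap_apply_of_ne_of_ne n1 n2]
      simp [arc, hc]
  have e1 := hcirc (Function.update s c true) p q
  have e2 := hcirc s p q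
  rw [hmul, sameCycle_mul_swap _ hne, ← e2] at e1
  exact e1

/-! ### The cube of smoothings and the chain complexes -/

variable (D) in
/-- An enhanced state: a complete smoothing with a label in `{1, x}` on each of its circles. The
enhanced states with smoothing `s` are the standard basis of the tensor power of `A` indexed by the
circles of `s`. -/
abbrev EnhancedState : Type := Σ s : D.Smoothing, (Circle s → Label)

noncomputable instance : DecidableEq D.EnhancedState := Classical.decEq _

/-- The label of the circle through a half-edge. -/
def label (S : D.EnhancedState) (h : HalfEdge D.crossings) : Label := S.2 (circleOf S.1 h)

end LinkDiagram

/-- The structure constants of a pair of linear maps `m : A ⊗ A → A` and `Δ : A → A ⊗ A`, where `A`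
is free over `R` on `{1, x}`. -/
structure PantsMaps (R : Type) where
  /-- `mul a b c` is the coefficient of `c` in `m (a ⊗ b)` -/
  mul : Label → Label → Label → R
  /-- `comul a b c` is the coefficient of `b ⊗ c` in `Δ a` -/
  comul : Label → Label → Label → R

open Label in
/-- The multiplication and comultiplication of Khovanov homology over the field of two elements:
`1 1 = 1`, `1 x = x 1 = x`, `x x = 0` and `Δ 1 = 1 ⊗ x + x ⊗ 1`, `Δ x = x ⊗ x`. -/
def khovanovMaps : PantsMaps (ZMod 2) where
  mul
    | one, one, one => 1
    | one, x, x => 1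
    | x, one, x => 1
    | _, _, _ => 0
  comul
    | one, one, x => 1
    | one, x, one => 1
    | x, x, x => 1
    | _, _, _ => 0

open Label in
/-- The maps which define `β`: `m (x ⊗ x) = x` and `Δ 1 = 1 ⊗ 1`; the other basis elements are sent
to zero. -/
def betaMaps : PantsMaps (ZMod 2) where
  mul
    | x, x, x => 1
    | _, _, _ => 0
  comul
    | one, one, one => 1
    | _, _, _ => 0

open Label in
/-- The multiplication and comultiplication of Bar-Natan's theory over the polynomial ring in `u`
over the field of two elements: `1 1 = 1`, `1 x = x 1 = x`, `x x = u x` and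
`Δ 1 = 1 ⊗ x + x ⊗ 1 + u (1 ⊗ 1)`, `Δ x = x ⊗ x`. -/
noncomputable def barNatanMaps : PantsMaps (Polynomial (ZMod 2)) where
  mul
    | one, one, one => 1
    | one, x, x => 1
    | x, one, x => 1
    | x, x, x => Polynomial.X
    | _, _, _ => 0
  comul
    | one, one, x => 1
    | one, x, one => 1
    | one, one, one => Polynomial.X
    | x, x, x => 1
    | _, _, _ => 0

namespace LinkDiagram

variable {D : LinkDiagram}

/-- The enhanced states `S` and `T` have the same labels on the circles which do not meet the
crossing `c`. -/
def AgreeAwayFrom (c : Fin D.crossings) (S T : D.EnhancedState) : Prop :=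
  (∀ h, (∀ p, circleOf S.1 h ≠ circleOf S.1 (c, p)) → label T h = label S h) ∧
    ∀ i, T.2 (Sum.inr i) = S.2 (Sum.inr i)

open Classical in
/-- The matrix coefficient from `S` to `T` of the map attached to an edge of the cube of smoothings
at which the smoothing of the crossing `c` changes from `0` to `1`. The circles which do not meet
`c` are unchanged. The circles of `S` which meet `c` pass through `(c, 0)` and `(c, 2)`, and so do
those of `T`: either two circles merge, and `m` is applied, or one circle splits, and `Δ` is
applied. -/
noncomputable def edgeCoeff {R : Type} [Zero R] (P : PantsMaps R) (c : Fin D.crossings)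
    (S T : D.EnhancedState) : R :=
  if AgreeAwayFrom c S T then
    if circleOf S.1 (c, 0) ≠ circleOf S.1 (c, 2) ∧ circleOf T.1 (c, 0) = circleOf T.1 (c, 2) then
      P.mul (label S (c, 0)) (label S (c, 2)) (label T (c, 0))
    else if circleOf S.1 (c, 0) = circleOf S.1 (c, 2) ∧
        circleOf T.1 (c, 0) ≠ circleOf T.1 (c, 2) then
      P.comul (label S (c, 0)) (label T (c, 0)) (label T (c, 2))
    else 0
  else 0

variable (D) in
open Classical in
/-- The sum over all edges of the cube of smoothings of the maps attached to them, as a matrix in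
the basis of enhanced states. -/
noncomputable def cubeMatrix {R : Type} [AddCommMonoid R] (P : PantsMaps R) :
    Matrix D.EnhancedState D.EnhancedState R := fun T S =>
  ∑ c, if S.1 c = false ∧ T.1 = Function.update S.1 c true then edgeCoeff P c S T else 0

/-! #### The circles away from a crossing -/

/-- The smoothings `s` and `s'` differ at most at the crossing `c`. -/
def SameAwayFrom (c : Fin D.crossings) (s s' : D.Smoothing) : Prop := ∀ c', c' ≠ c → s c' = s' c'

/-- The half-edge `h` lies on a circle of `s` which does not meet `c`. -/
def Off (c : Fin D.crossings) (s : D.Smoothing) (h : HalfEdge D.crossings) : Prop :=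
  ∀ p, circleOf s h ≠ circleOf s (c, p)

lemma circleOf_opp (s : D.Smoothing) (h) : circleOf s (D.opp h) = circleOf s h :=
  congrArg Sum.inl (Quot.sound (r := Adj s) (Or.inl rfl)).symm

lemma circleOf_arc (s : D.Smoothing) (h) : circleOf s (arc s h) = circleOf s h :=
  congrArg Sum.inl (Quot.sound (r := Adj s) (Or.inr rfl)).symm

lemma circleOf_eq_of_off {c : Fin D.crossings} {s s' : D.Smoothing} (hs : SameAwayFrom c s s')
    {h h' : HalfEdge D.crossings} (ho : Off c s h) (e : circleOf s' h = circleOf s' h') :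
    circleOf s h = circleOf s h' := by
  have e' : (Quot.mk _ h : Quot (Adj s')) = Quot.mk _ h' := Sum.inl.inj e
  let ψ : HalfEdge D.crossings → Prop := fun k => circleOf s h = circleOf s k
  have hψ : ∀ a b, Adj s' a b → ψ a = ψ b := by
    rintro a b (rfl | rfl)
    · simp only [ψ, circleOf_opp]
    · by_cases hc : a.1 = c
      · have h1 : ¬ ψ a := by
          obtain ⟨a1, a2⟩ := a
          subst hc
          exact ho a2
        have h2 : ¬ ψ (arc s' a) := by
          obtain ⟨a1, a2⟩ := a
          subst hc
          exact ho _
        simp [h1, h2]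
      · have : arc s' a = arc s a := by simp only [arc, hs _ hc]
        simp only [ψ, this, circleOf_arc]
  have := congrArg (Quot.lift ψ hψ) e'
  change ψ h = ψ h' at this
  exact this.mp rfl

lemma Off.of_same {c : Fin D.crossings} {s s' : D.Smoothing} (hs : SameAwayFrom c s s')
    {h : HalfEdge D.crossings} (ho : Off c s h) : Off c s' h := fun p e =>
  ho p (circleOf_eq_of_off hs ho e)

lemma SameAwayFrom.symm {c : Fin D.crossings} {s s' : D.Smoothing} (hs : SameAwayFrom c s s') :
    SameAwayFrom c s' s := fun c' h => (hs c' h).symm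

lemma off_iff {c : Fin D.crossings} {s : D.Smoothing} {h : HalfEdge D.crossings} :
    Off c s h ↔ circleOf s h ≠ circleOf s (c, 0) ∧ circleOf s h ≠ circleOf s (c, 2) := by
  refine ⟨fun ho => ⟨ho 0, ho 2⟩, fun ⟨h0, h2⟩ p => ?_⟩
  have e0 := circleOf_arc s (c, 0)
  have e2 := circleOf_arc s (c, 2)
  cases hc : s c
  · have e0' : circleOf s (c, 1) = circleOf s (c, 0) := by simpa [arc, hc] using e0
    have e2' : circleOf s (c, 3) = circleOf s (c, 2) := by simpa [arc, hc] using e2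
    fin_cases p
    · exact h0
    · exact fun e => h0 (e.trans e0')
    · exact h2
    · exact fun e => h2 (e.trans e2')
  · have e0' : circleOf s (c, 3) = circleOf s (c, 0) := by simpa [arc, hc] using e0
    have e2' : circleOf s (c, 1) = circleOf s (c, 2) := by simpa [arc, hc] using e2
    fin_cases p
    · exact h0
    · exact fun e => h2 (e.trans e2')
    · exact h2
    · exact fun e => h0 (e.trans e0')

/-- The circles of `s` which do not meet `c`. -/
abbrev OffCircle (c : Fin D.crossings) (s : D.Smoothing) : Type :=
  {C : Circle s // C ≠ circleOf s (c, 0) ∧ C ≠ circleOf s (c, 2)}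

/-- A choice of a circle of `s'` through a point of a given circle of `s`. -/
noncomputable def circleMap (s s' : D.Smoothing) : Circle s → Circle s' :=
  Sum.map (fun q => Quot.mk _ q.out) id

lemma circleMap_circleOf {c : Fin D.crossings} {s s' : D.Smoothing} (hs : SameAwayFrom c s s')
    {h : HalfEdge D.crossings} (ho : Off c s h) :
    circleMap s s' (circleOf s h) = circleOf s' h := by
  have e : circleOf s h = circleOf s (Quot.out (Quot.mk (Adj s) h)) :=
    congrArg Sum.inl (Quot.out_eq _).symm
  exact (circleOf_eq_of_off hs.symm (ho.of_same hs) e).symm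

lemma circleMap_off {c : Fin D.crossings} {s s' : D.Smoothing} (hs : SameAwayFrom c s s')
    (C : OffCircle c s) : circleMap s s' C.1 ≠ circleOf s' (c, 0) ∧
      circleMap s s' C.1 ≠ circleOf s' (c, 2) := by
  obtain ⟨C | i, hC⟩ := C
  · induction C using Quot.ind with
    | mk h =>
      have ho : Off c s h := off_iff.2 hC
      have := circleMap_circleOf hs ho
      change circleMap s s' (circleOf s h) ≠ _ ∧ circleMap s s' (circleOf s h) ≠ _
      rw [this]
      exact off_iff.1 (ho.of_same hs)
  · exact ⟨Sum.inr_ne_inl, Sum.inr_ne_inl⟩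

lemma circleMap_circleMap {c : Fin D.crossings} {s s' : D.Smoothing} (hs : SameAwayFrom c s s')
    (C : OffCircle c s) : circleMap s' s (circleMap s s' C.1) = C.1 := by
  obtain ⟨C | i, hC⟩ := C
  · induction C using Quot.ind with
    | mk h =>
      have ho : Off c s h := off_iff.2 hC
      change circleMap s' s (circleMap s s' (circleOf s h)) = circleOf s h
      rw [circleMap_circleOf hs ho, circleMap_circleOf hs.symm (ho.of_same hs)]
  · rfl

/-- If two smoothings differ only at `c`, they have the same circles away from `c`. -/
noncomputable def offEquiv {c : Fin D.crossings} {s s' : D.Smoothing} (hs : SameAwayFrom c s s') :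
    OffCircle c s ≃ OffCircle c s' where
  toFun C := ⟨circleMap s s' C.1, circleMap_off hs C⟩
  invFun C := ⟨circleMap s' s C.1, circleMap_off hs.symm C⟩
  left_inv C := Subtype.ext (circleMap_circleMap hs C)
  right_inv C := Subtype.ext (circleMap_circleMap hs.symm C)

@[to_additive]
lemma prod_circle {M : Type} [CommMonoid M] (c : Fin D.crossings) (s : D.Smoothing)
    (g : Circle s → M) : ∏ C, g C =
      (if circleOf s (c, 0) = circleOf s (c, 2) then g (circleOf s (c, 0))
        else g (circleOf s (c, 0)) * g (circleOf s (c, 2))) * ∏ C : OffCircle c s, g C.1 := by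
  have h1 : ∏ C : OffCircle c s, g C.1 =
      ∏ C ∈ Finset.univ.filter
        (fun C => C ≠ circleOf s (c, 0) ∧ C ≠ circleOf s (c, 2)), g C :=
    (Finset.prod_subtype _ (by simp) g).symm
  rw [h1, ← Finset.prod_filter_mul_prod_filter_not Finset.univ
    (fun C => C ≠ circleOf s (c, 0) ∧ C ≠ circleOf s (c, 2)), mul_comm]
  congr 1
  have h2 : Finset.univ.filter (fun C => ¬ (C ≠ circleOf s (c, 0) ∧ C ≠ circleOf s (c, 2))) =
      {circleOf s (c, 0), circleOf s (c, 2)} := by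
    ext C
    simp only [Finset.mem_filter, Finset.mem_univ, true_and, Finset.mem_insert,
      Finset.mem_singleton]
    tauto
  rw [h2]
  split_ifs with h
  · rw [← h]; simp
  · rw [Finset.prod_pair h]

@[to_additive]
lemma prod_off {M : Type} [CommMonoid M] {c : Fin D.crossings} {s s' : D.Smoothing}
    (hs : SameAwayFrom c s s') (g : Circle s → M) (g' : Circle s' → M)
    (hg : ∀ C : OffCircle c s, g' (circleMap s s' C.1) = g C.1) :
    ∏ C : OffCircle c s, g C.1 = ∏ C : OffCircle c s', g' C.1 :=
  Fintype.prod_equiv (offEquiv hs) _ _ fun C => (hg C).symm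

lemma sameAwayFrom_update (c : Fin D.crossings) (s : D.Smoothing) (b : Bool) :
    SameAwayFrom c s (Function.update s c b) := fun c' h => by simp [h]

/-- Agreement of labels in terms of circles. -/
lemma agreeAwayFrom_iff {c : Fin D.crossings} {S T : D.EnhancedState}
    (hs : SameAwayFrom c S.1 T.1) : AgreeAwayFrom c S T ↔
      ∀ C : Circle T.1, C ≠ circleOf T.1 (c, 0) → C ≠ circleOf T.1 (c, 2) →
        T.2 C = S.2 (circleMap T.1 S.1 C) := by
  constructor
  · rintro ⟨h1, h2⟩ (C | i) hC hC'
    · induction C using Quot.ind with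
      | mk h =>
        have ho : Off c T.1 h := off_iff.2 ⟨hC, hC'⟩
        have e := circleMap_circleOf hs.symm ho
        have := h1 h (ho.of_same hs.symm)
        change T.2 (circleOf T.1 h) = S.2 (circleMap T.1 S.1 (circleOf T.1 h))
        rw [e]
        exact this
    · exact h2 i
  · intro H
    refine ⟨fun h ho => ?_, fun i => H (Sum.inr i) Sum.inr_ne_inl Sum.inr_ne_inl⟩
    have ho' : Off c T.1 h := Off.of_same hs ho
    have := H (circleOf T.1 h) (off_iff.1 ho').1 (off_iff.1 ho').2
    rw [circleMap_circleOf hs.symm ho'] at this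
    exact this

/-! #### The square of the differential vanishes -/

section square

open Polynomial

/-- The values of `1` and `x` under the two characters `x ↦ 0` and `x ↦ u` of the Bar-Natan
algebra. -/
noncomputable def charVal : Label → Bool → (ZMod 2)[X]
  | Label.one, _ => 1
  | Label.x, false => 0
  | Label.x, true => X

/-- The inverse of `charVal`, up to the factor `u`. -/
noncomputable def charInv : Label → Bool → (ZMod 2)[X]
  | Label.one, false => X
  | Label.one, true => 0
  | Label.x, _ => 1

lemma sum_label {M : Type} [AddCommMonoid M] (f : Label → M) :
    ∑ a, f a = f Label.one + f Label.x := by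
  have : (Finset.univ : Finset Label) = {Label.one, Label.x} := rfl
  rw [this, Finset.sum_pair (by decide)]

lemma poly_add_self (p : (ZMod 2)[X]) : p + p = 0 := CharTwo.add_self_eq_zero p

lemma charInv_charVal (a b : Label) :
    ∑ k, charInv a k * charVal b k = if a = b then X else 0 := by
  rw [Fintype.sum_bool]
  cases a <;> cases b <;> simp [charInv, charVal, poly_add_self]

lemma charVal_mul (a b : Label) (k : Bool) :
    ∑ c, barNatanMaps.mul a b c * charVal c k = charVal a k * charVal b k := by
  rw [sum_label]
  cases a <;> cases b <;> cases k <;> simp [barNatanMaps, charVal]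

lemma charVal_comul (a : Label) (k l : Bool) :
    ∑ b, ∑ c, barNatanMaps.comul a b c * (charVal b k * charVal c l) =
      if k = l then X * charVal a k else 0 := by
  simp only [sum_label]
  cases a <;> cases k <;> cases l <;> simp [barNatanMaps, charVal, poly_add_self]

lemma sum_update_one {Y M : Type} [Fintype Y] [DecidableEq Y] [AddCommMonoid M] (L : Y → Label)
    (R : Y) (F : (Y → Label) → M) [DecidablePred fun l : Y → Label => ∀ y, y ≠ R → l y = L y] :
    ∑ l : Y → Label, (if ∀ y, y ≠ R → l y = L y then F l else 0) =
      ∑ b, F (Function.update L R b) := by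
  rw [← Finset.sum_filter]
  refine Finset.sum_nbij' (fun l => l R) (fun b => Function.update L R b) ?_ ?_ ?_ ?_ ?_
  · simp
  · intro b _
    simp +contextual
  · intro l hl
    have hl := (Finset.mem_filter.1 hl).2
    ext1 y
    by_cases h : y = R
    · subst h; simp
    · simp [h, hl y h]
  · simp
  · intro l hl
    have hl := (Finset.mem_filter.1 hl).2
    congr 1
    ext1 y
    by_cases h : y = R
    · subst h; simp
    · simp [h, hl y h]

lemma sum_update_two {Y M : Type} [Fintype Y] [DecidableEq Y] [AddCommMonoid M] (L : Y → Label)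
    {R R' : Y} (hR : R ≠ R') (F : (Y → Label) → M)
    [DecidablePred fun l : Y → Label => ∀ y, y ≠ R → y ≠ R' → l y = L y] :
    ∑ l : Y → Label, (if ∀ y, y ≠ R → y ≠ R' → l y = L y then F l else 0) =
      ∑ b, ∑ b', F (Function.update (Function.update L R b) R' b') := by
  rw [← Finset.sum_filter, ← Finset.sum_product']
  have key : ∀ l : Y → Label, (∀ y, y ≠ R → y ≠ R' → l y = L y) →
      Function.update (Function.update L R (l R)) R' (l R') = l := by
    intro l hl
    ext1 y
    by_cases h' : y = R'
    · subst h'; simp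
    · by_cases h : y = R
      · subst h; simp [h']
      · simp [h, h', hl y h h']
  refine Finset.sum_nbij' (fun l => (l R, l R'))
    (fun b => Function.update (Function.update L R b.1) R' b.2) ?_ ?_ ?_ ?_ ?_
  · simp
  · intro b _
    simp +contextual
  · intro l hl
    exact key l (Finset.mem_filter.1 hl).2
  · intro b _
    simp [hR]
  · intro l hl
    simp only [key l (Finset.mem_filter.1 hl).2]

/-- A colouring of half-edges and loops which is constant on the circles of `s`. -/
def Compat (s : D.Smoothing) (f : HalfEdge D.crossings → Bool) : Prop :=
  ∀ h h', Adj s h h' → f h = f h'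

/-- The induced colouring of circles. -/
def circleColour {s : D.Smoothing} {f : HalfEdge D.crossings → Bool} (hf : Compat s f)
    (l : Fin D.loops → Bool) : Circle s → Bool := Sum.elim (Quot.lift f hf) l

lemma circleColour_circleMap {s s' : D.Smoothing} {f : _ → Bool}
    (hf : Compat s f) (hf' : Compat s' f) (l : Fin D.loops → Bool) (C : Circle s) :
    circleColour hf' l (circleMap s s' C) = circleColour hf l C := by
  obtain C | i := C
  · change f C.out = Quot.lift f hf C
    conv_rhs => rw [← Quot.out_eq C]
  · rfl

open Classical in
/-- The change of basis to idempotents. -/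
noncomputable def charSum (v : D.EnhancedState → (ZMod 2)[X]) (s : D.Smoothing)
    (f : HalfEdge D.crossings → Bool) (l : Fin D.loops → Bool) : (ZMod 2)[X] :=
  if hf : Compat s f then ∑ a : Circle s → Label, v ⟨s, a⟩ * ∏ C, charVal (a C) (circleColour hf l C)
  else 0

lemma eq_zero_of_charSum (v : D.EnhancedState → (ZMod 2)[X])
    (h : ∀ s f l, charSum v s f l = 0) : v = 0 := by
  classical
  ext1 ⟨s, a⟩
  have key : ∑ k : Circle s → Bool, (∏ C, charInv (a C) (k C)) *
      ∑ b : Circle s → Label, v ⟨s, b⟩ * ∏ C, charVal (b C) (k C) =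
      v ⟨s, a⟩ * X ^ Fintype.card (Circle s) := by
    have : ∀ b : Circle s → Label, ∑ k : Circle s → Bool,
        (∏ C, charInv (a C) (k C)) * ∏ C, charVal (b C) (k C) =
        if a = b then X ^ Fintype.card (Circle s) else 0 := by
      intro b
      simp only [← Finset.prod_mul_distrib]
      have := (Finset.prod_univ_sum (fun _ : Circle s => (Finset.univ : Finset Bool))
        (fun C k => charInv (a C) k * charVal (b C) k)).symm
      rw [Fintype.piFinset_univ] at this
      rw [this]
      simp only [charInv_charVal]
      split_ifs with hab
      · subst hab; simp
      · obtain ⟨C, hC⟩ := Function.ne_iff.1 hab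
        exact Finset.prod_eq_zero (Finset.mem_univ C) (if_neg hC)
    simp only [Finset.mul_sum]
    rw [Finset.sum_comm]
    have e : ∀ b : Circle s → Label, ∑ k : Circle s → Bool,
        (∏ C, charInv (a C) (k C)) * (v ⟨s, b⟩ * ∏ C, charVal (b C) (k C)) =
        v ⟨s, b⟩ * if a = b then X ^ Fintype.card (Circle s) else 0 := by
      intro b
      rw [← this, Finset.mul_sum]
      exact Finset.sum_congr rfl fun k _ => by ring
    simp only [e]
    simp
  have zero : ∀ k : Circle s → Bool,
      ∑ b : Circle s → Label, v ⟨s, b⟩ * ∏ C, charVal (b C) (k C) = 0 := by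
    intro k
    have hf : Compat s (fun h => k (circleOf s h)) := by
      rintro h h' (rfl | rfl)
      · simp only [circleOf_opp]
      · simp only [circleOf_arc]
    have := h s (fun h => k (circleOf s h)) (fun i => k (Sum.inr i))
    rw [charSum, dif_pos hf] at this
    have hk : circleColour hf (fun i => k (Sum.inr i)) = k := by
      ext1 C
      obtain C | i := C
      · induction C using Quot.ind; rfl
      · rfl
    rwa [hk] at this
  simp only [zero, mul_zero, Finset.sum_const_zero] at key
  have hX : (X : (ZMod 2)[X]) ^ Fintype.card (Circle s) ≠ 0 := pow_ne_zero _ X_ne_zero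
  exact (mul_eq_zero.1 key.symm).resolve_right hX

open Classical in
/-- The number of splits, `0` or `1`, at the edge of the cube which ends at `s` and changes `c`. -/
noncomputable def splits (s : D.Smoothing) (c : Fin D.crossings) : ℕ :=
  if circleOf s (c, 0) = circleOf s (c, 2) then 0 else 1

lemma card_circle_update (s : D.Smoothing) (c : Fin D.crossings) (hs : s c = true) :
    Fintype.card (Circle s) + 1 =
      Fintype.card (Circle (Function.update s c false)) + 2 * splits s c := by
  set s₀ := Function.update s c false with hs₀
  have hsame : SameAwayFrom c s₀ s := (sameAwayFrom_update c s false).symm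
  have hs' : Function.update s₀ c true = s := by
    rw [hs₀, Function.update_idem, ← hs, Function.update_eq_self]
  have hx := merge_xor_split s₀ c (by simp [hs₀])
  rw [hs'] at hx
  have c1 := sum_circle c s (fun _ => 1)
  have c0 := sum_circle c s₀ (fun _ => 1)
  have ho := sum_off hsame (fun _ => 1) (fun _ => 1) (fun _ => rfl)
  simp only [Finset.sum_const, Finset.card_univ, smul_eq_mul, mul_one] at c1 c0 ho
  rw [c1, c0, ho, splits]
  by_cases h : circleOf s (c, 0) = circleOf s (c, 2)
  · rw [if_pos h, if_neg (hx.1 h), if_pos h]; ring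
  · rw [if_neg h, if_pos (not_not.1 fun h' => h (hx.2 h')), if_neg h]; ring

/-- A colouring is constant near a crossing. -/
def ConstAt (f : HalfEdge D.crossings → Bool) (c : Fin D.crossings) : Prop :=
  ∀ p, f (c, p) = f (c, 0)

lemma compat_iff {f : HalfEdge D.crossings → Bool} {c : Fin D.crossings} (hc : ConstAt f c)
    {s s' : D.Smoothing} (hs : SameAwayFrom c s s') (hf : Compat s f) : Compat s' f := by
  rintro h h' (rfl | rfl)
  · exact hf _ _ (Or.inl rfl)
  · by_cases hh : h.1 = c
    · obtain ⟨c', p⟩ := h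
      subst hh
      exact (hc p).trans (hc _).symm
    · have : arc s' h = arc s h := by simp only [arc, hs _ hh]
      rw [this]
      exact hf _ _ (Or.inr rfl)

lemma Compat.eq_of_circleOf {f : HalfEdge D.crossings → Bool} {s : D.Smoothing} (hf : Compat s f)
    {h h' : HalfEdge D.crossings} (e : circleOf s h = circleOf s h') : f h = f h' :=
  congrArg (Quot.lift f hf) (Sum.inl.inj e)

open Classical in
/-- The map attached to one edge of the cube, in the basis of idempotents. -/
lemma charSum_edge (s s₀ : D.Smoothing) (c : Fin D.crossings) (hs : s c = true)
    (hs₀ : s₀ = Function.update s c false)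
    (f : HalfEdge D.crossings → Bool) (hf : Compat s f) (l : Fin D.loops → Bool)
    (hf₀ : ConstAt f c → Compat s₀ f)
    (a : Circle s₀ → Label) :
    ∑ b : Circle s → Label, edgeCoeff barNatanMaps c ⟨s₀, a⟩ ⟨s, b⟩ *
        ∏ C, charVal (b C) (circleColour hf l C) =
      if h : ConstAt f c then X ^ splits s c * ∏ C, charVal (a C) (circleColour (hf₀ h) l C)
      else 0 := by
  have hsame : SameAwayFrom c s₀ s := hs₀ ▸ (sameAwayFrom_update c s false).symm
  have hs' : Function.update s₀ c true = s := by
    rw [hs₀, Function.update_idem, ← hs, Function.update_eq_self]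
  have hx := merge_xor_split s₀ c (by simp [hs₀])
  rw [hs'] at hx
  let L : Circle s → Label := fun C => a (circleMap s s₀ C)
  have f03 : f (c, 3) = f (c, 0) := (hf _ _ (Or.inr (by simp [arc, hs]))).symm
  have f12 : f (c, 1) = f (c, 2) := (hf _ _ (Or.inr (by simp [arc, hs]))).symm
  have hconst : ConstAt f c ↔ f (c, 0) = f (c, 2) := by
    refine ⟨fun h => (h 2).symm, fun h p => ?_⟩
    fin_cases p
    · rfl
    · exact f12.trans h.symm
    · exact h.symm
    · exact f03
  have col : ∀ p, circleColour hf l (circleOf s (c, p)) = f (c, p) := fun p => rfl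
  by_cases h : circleOf s (c, 0) = circleOf s (c, 2)
  · -- merge
    have h0 := hx.1 h
    have hc : ConstAt f c := hconst.2 (hf.eq_of_circleOf h)
    have e1 : ∀ b : Circle s → Label,
        edgeCoeff barNatanMaps c ⟨s₀, a⟩ ⟨s, b⟩ * ∏ C, charVal (b C) (circleColour hf l C) =
        if ∀ C, C ≠ circleOf s (c, 0) → b C = L C then
          barNatanMaps.mul (a (circleOf s₀ (c, 0))) (a (circleOf s₀ (c, 2)))
            (b (circleOf s (c, 0))) * ∏ C, charVal (b C) (circleColour hf l C) else 0 := by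
      intro b
      have hag : AgreeAwayFrom c (⟨s₀, a⟩ : D.EnhancedState) ⟨s, b⟩ ↔
          ∀ C, C ≠ circleOf s (c, 0) → b C = L C := by
        rw [agreeAwayFrom_iff hsame]
        exact ⟨fun H C h1 => H C h1 (h ▸ h1), fun H C h1 _ => H C h1⟩
      simp only [edgeCoeff, hag]
      split_ifs with g1 g2 g3
      · rfl
      · exact absurd ⟨h0, h⟩ g2
      · exact absurd ⟨h0, h⟩ g2
      · rw [zero_mul]
    rw [Finset.sum_congr rfl fun b _ => e1 b, sum_update_one, dif_pos hc, splits, if_pos h,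
      pow_zero, one_mul, prod_circle c s₀, if_neg h0]
    have e2 : ∀ b, ∏ C, charVal (Function.update L (circleOf s (c, 0)) b C) (circleColour hf l C) =
        charVal b (f (c, 0)) *
          ∏ C : OffCircle c s₀, charVal (a C.1) (circleColour (hf₀ hc) l C.1) := by
      intro b
      rw [prod_circle c s, if_pos h, Function.update_self, col]
      congr 1
      refine (prod_off hsame (fun C => charVal (a C) (circleColour (hf₀ hc) l C))
        (fun C => charVal (Function.update L (circleOf s (c, 0)) b C)
          (circleColour hf l C)) fun C => ?_).symm
      rw [Function.update_of_ne (circleMap_off hsame C).1, circleColour_circleMap (hf₀ hc) hf]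
      simp only [L]
      rw [circleMap_circleMap hsame]
    simp only [e2, Function.update_self, ← mul_assoc]
    rw [← Finset.sum_mul, charVal_mul]
    congr 2
    change _ = charVal _ (f (c, 2))
    rw [hc 2]
  · -- split
    have h0 : circleOf s₀ (c, 0) = circleOf s₀ (c, 2) := not_not.1 fun h' => h (hx.2 h')
    have e1 : ∀ b : Circle s → Label,
        edgeCoeff barNatanMaps c ⟨s₀, a⟩ ⟨s, b⟩ * ∏ C, charVal (b C) (circleColour hf l C) =
        if ∀ C, C ≠ circleOf s (c, 0) → C ≠ circleOf s (c, 2) → b C = L C then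
          barNatanMaps.comul (a (circleOf s₀ (c, 0))) (b (circleOf s (c, 0)))
            (b (circleOf s (c, 2))) * ∏ C, charVal (b C) (circleColour hf l C) else 0 := by
      intro b
      have hag : AgreeAwayFrom c (⟨s₀, a⟩ : D.EnhancedState) ⟨s, b⟩ ↔
          ∀ C, C ≠ circleOf s (c, 0) → C ≠ circleOf s (c, 2) → b C = L C :=
        agreeAwayFrom_iff hsame
      simp only [edgeCoeff, hag]
      split_ifs with g1 g2 g3
      · exact absurd g2.2 h
      · rfl
      · exact absurd ⟨h0, h⟩ g3
      · rw [zero_mul]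
    rw [Finset.sum_congr rfl fun b _ => e1 b, sum_update_two _ h]
    have e2 : ∀ b b', ∏ C, charVal (Function.update (Function.update L (circleOf s (c, 0)) b)
          (circleOf s (c, 2)) b' C) (circleColour hf l C) =
        (charVal b (f (c, 0)) * charVal b' (f (c, 2))) *
          ∏ C : OffCircle c s, charVal (L C.1) (circleColour hf l C.1) := by
      intro b b'
      rw [prod_circle c s, if_neg h, Function.update_self, Function.update_of_ne h,
        Function.update_self, col, col]
      congr 1
      refine Finset.prod_congr rfl fun C _ => ?_
      rw [Function.update_of_ne C.2.2, Function.update_of_ne C.2.1]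
    simp only [e2, Function.update_self, Function.update_of_ne h]
    simp only [← mul_assoc _ _ (∏ C : OffCircle c s, charVal (L C.1) (circleColour hf l C.1)),
      ← Finset.sum_mul]
    rw [charVal_comul]
    by_cases hk : f (c, 0) = f (c, 2)
    · have hc := hconst.2 hk
      rw [if_pos hk, dif_pos hc, splits, if_neg h, pow_one, prod_circle c s₀, if_pos h0, mul_assoc]
      congr 2
      refine (prod_off hsame (fun C => charVal (a C) (circleColour (hf₀ hc) l C))
        (fun C => charVal (L C) (circleColour hf l C)) fun C => ?_).symm
      rw [circleColour_circleMap (hf₀ hc) hf]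
      simp only [L]
      rw [circleMap_circleMap hsame]
    · rw [if_neg hk, zero_mul, dif_neg fun h => hk (hconst.1 h)]

variable (D) in
/-- Bar-Natan's differential `d`, as a linear map over the polynomial ring in `u`. -/
noncomputable def barNatanD :
    (D.EnhancedState → (ZMod 2)[X]) →ₗ[(ZMod 2)[X]] (D.EnhancedState → (ZMod 2)[X]) :=
  (D.cubeMatrix barNatanMaps).mulVecLin

open Classical in
lemma charSum_barNatanD (v : D.EnhancedState → (ZMod 2)[X]) (s : D.Smoothing)
    (f : HalfEdge D.crossings → Bool) (l : Fin D.loops → Bool) :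
    charSum (D.barNatanD v) s f l = ∑ c, if s c = true ∧ ConstAt f c then
      X ^ splits s c * charSum v (Function.update s c false) f l else 0 := by
  by_cases hf : Compat s f
  swap
  · rw [charSum, dif_neg hf]
    symm
    refine Finset.sum_eq_zero fun c _ => ?_
    split_ifs with h
    · have : ¬ Compat (Function.update s c false) f := fun h' =>
        hf (compat_iff h.2 (sameAwayFrom_update c s false).symm h')
      rw [charSum, dif_neg this, mul_zero]
    · rfl
  have e1 : ∀ b : Circle s → Label, D.barNatanD v ⟨s, b⟩ =
      ∑ c, if s c = true then ∑ a : Circle (Function.update s c false) → Label,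
        edgeCoeff barNatanMaps c ⟨Function.update s c false, a⟩ ⟨s, b⟩ *
          v ⟨Function.update s c false, a⟩ else 0 := by
    intro b
    change ∑ S, D.cubeMatrix barNatanMaps ⟨s, b⟩ S * v S = _
    simp only [cubeMatrix, Finset.sum_mul]
    rw [Finset.sum_comm]
    refine Finset.sum_congr rfl fun c _ => ?_
    rw [Fintype.sum_sigma]
    split_ifs with hc
    · rw [Finset.sum_eq_single (Function.update s c false)]
      · refine Finset.sum_congr rfl fun a _ => ?_
        rw [if_pos]
        refine ⟨by simp, ?_⟩
        rw [Function.update_idem, ← hc, Function.update_eq_self]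
      · intro s₀ _ hne
        refine Finset.sum_eq_zero fun a _ => ?_
        rw [if_neg, zero_mul]
        rintro ⟨h1, h2⟩
        refine hne ?_
        simp only at h1 h2
        rw [h2, Function.update_idem, ← h1, Function.update_eq_self]
      · simp
    · refine Finset.sum_eq_zero fun s₀ _ => Finset.sum_eq_zero fun a _ => ?_
      rw [if_neg, zero_mul]
      rintro ⟨h1, h2⟩
      simp only at h2
      exact hc (by rw [h2]; simp)
  rw [charSum, dif_pos hf]
  simp only [e1, Finset.sum_mul]
  rw [Finset.sum_comm]
  refine Finset.sum_congr rfl fun c _ => ?_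
  by_cases hc : s c = true
  swap
  · simp [hc]
  have hf₀ : ConstAt f c → Compat (Function.update s c false) f := fun h =>
    compat_iff h (sameAwayFrom_update c s false) hf
  simp only [hc, if_true, true_and]
  have e2 : ∀ b : Circle s → Label,
      (∑ a : Circle (Function.update s c false) → Label,
        edgeCoeff barNatanMaps c ⟨Function.update s c false, a⟩ ⟨s, b⟩ *
          v ⟨Function.update s c false, a⟩) * ∏ C, charVal (b C) (circleColour hf l C) =
      ∑ a : Circle (Function.update s c false) → Label, v ⟨Function.update s c false, a⟩ *
        (edgeCoeff barNatanMaps c ⟨Function.update s c false, a⟩ ⟨s, b⟩ *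
          ∏ C, charVal (b C) (circleColour hf l C)) := by
    intro b
    rw [Finset.sum_mul]
    exact Finset.sum_congr rfl fun a _ => by ring
  rw [Finset.sum_congr rfl fun b _ => e2 b, Finset.sum_comm]
  simp only [← Finset.mul_sum, charSum_edge s _ c hc rfl f hf l hf₀]
  by_cases hk : ConstAt f c
  · simp only [hk, dif_pos, if_true]
    rw [charSum, dif_pos (hf₀ hk), Finset.mul_sum]
    exact Finset.sum_congr rfl fun a _ => by ring
  · simp [hk]

lemma barNatanD_barNatanD (v : D.EnhancedState → (ZMod 2)[X]) :
    D.barNatanD (D.barNatanD v) = 0 := by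
  classical
  refine eq_zero_of_charSum _ fun s f l => ?_
  rw [charSum_barNatanD]
  let G : Fin D.crossings × Fin D.crossings → (ZMod 2)[X] := fun z =>
    if (s z.1 = true ∧ ConstAt f z.1) ∧ s z.2 = true ∧ ConstAt f z.2 ∧ z.1 ≠ z.2 then
      X ^ splits s z.1 * (X ^ splits (Function.update s z.1 false) z.2 *
        charSum v (Function.update (Function.update s z.1 false) z.2 false) f l) else 0
  have e : ∀ c, (if s c = true ∧ ConstAt f c then
      X ^ splits s c * charSum (D.barNatanD v) (Function.update s c false) f l else 0) =
      ∑ c', G (c, c') := by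
    intro c
    split_ifs with h
    · rw [charSum_barNatanD, Finset.mul_sum]
      refine Finset.sum_congr rfl fun c' _ => ?_
      by_cases hcc : c = c'
      · subst hcc; simp [G]
      · have hcc' : c' ≠ c := fun h => hcc h.symm
        simp only [G, h, Function.update_of_ne hcc', ne_eq, hcc, not_false_eq_true, and_true,
          true_and, mul_ite, mul_zero]
    · symm
      exact Finset.sum_eq_zero fun c' _ => if_neg fun h' => h h'.1
  rw [Finset.sum_congr rfl fun c _ => e c, ← Fintype.sum_prod_type]
  have symmG : ∀ z, G z.swap = G z := by
    rintro ⟨c, c'⟩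
    simp only [G, Prod.swap]
    by_cases h : (s c = true ∧ ConstAt f c) ∧ s c' = true ∧ ConstAt f c' ∧ c ≠ c'
    · have h' : (s c' = true ∧ ConstAt f c') ∧ s c = true ∧ ConstAt f c ∧ c' ≠ c := by tauto
      rw [if_pos h, if_pos h']
      have hne : c ≠ c' := h.2.2.2
      rw [Function.update_comm hne, ← mul_assoc, ← mul_assoc, ← pow_add, ← pow_add]
      congr 2
      have k1 := card_circle_update s c h.1.1
      have k2 := card_circle_update (Function.update s c false) c'
        (by rw [Function.update_of_ne hne.symm]; exact h.2.1)
      have k3 := card_circle_update s c' h.2.1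
      have k4 := card_circle_update (Function.update s c' false) c
        (by rw [Function.update_of_ne hne]; exact h.1.1)
      rw [Function.update_comm hne] at k2
      omega
    · rw [if_neg h, if_neg fun h' => h (by tauto)]
  refine Finset.sum_involution (fun z _ => z.swap) ?_ ?_ ?_ ?_
  · intro z _
    rw [symmG]
    exact poly_add_self _
  · rintro ⟨c, c'⟩ _ hz he
    apply hz
    have : c' = c := congrArg Prod.fst he
    subst this
    simp [G]
  · simp
  · simp

end square

/-! #### Gradings -/

/-- The degree of a label: `1` has degree `1` and `x` has degree `-1`. -/
def _root_.Label.deg : Label → ℤ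
  | Label.one => 1
  | Label.x => -1

/-- The number of `1`-smoothings. -/
def height (s : D.Smoothing) : ℤ := (Finset.univ.filter fun c => s c = true).card

variable (D) in
/-- The number of positive crossings. -/
def nPlus : ℤ := (Finset.univ.filter fun c => D.positive c = true).card

variable (D) in
/-- The number of negative crossings. -/
def nMinus : ℤ := (Finset.univ.filter fun c => D.positive c = false).card

/-- The homological grading of an enhanced state. -/
def hDeg (S : D.EnhancedState) : ℤ := height S.1 - D.nMinus

/-- The `q`-grading of an enhanced state. -/
noncomputable def qDeg (S : D.EnhancedState) : ℤ :=
  ∑ C, (S.2 C).deg + height S.1 + D.nPlus - 2 * D.nMinus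

variable (D) in
/-- The mod 2 Khovanov chain group in homological grading `i` and `q`-grading `j`. -/
def khChain (i j : ℤ) : Submodule (ZMod 2) (D.EnhancedState → ZMod 2) where
  carrier := {v | ∀ S, v S ≠ 0 → hDeg S = i ∧ qDeg S = j}
  add_mem' {v w} hv hw S hS := by
    by_cases h : v S = 0
    · exact hw S fun h' => hS (by simp [h, h'])
    · exact hv S h
  zero_mem' S hS := absurd rfl hS
  smul_mem' a v hv S hS := hv S fun h => hS (by simp [h])

variable (D) in
/-- The Bar-Natan chain group in homological grading `i` and `q`-grading `j`, where `u` has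
homological grading `0` and `q`-grading `-2`. -/
def bnChain (i j : ℤ) : Submodule (ZMod 2) (D.EnhancedState → Polynomial (ZMod 2)) where
  carrier := {v | ∀ S p, (v S).coeff p ≠ 0 → hDeg S = i ∧ qDeg S - 2 * p = j}
  add_mem' {v w} hv hw S p hS := by
    by_cases h : (v S).coeff p = 0
    · exact hw S p fun h' => hS (by simp [h, h'])
    · exact hv S p h
  zero_mem' S p hS := absurd (by simp) hS
  smul_mem' a v hv S p hS := hv S p fun h => hS (by simp [h])

variable (D) in
/-- The differential `∂` of the mod 2 Khovanov complex. -/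
noncomputable def khovanovD : (D.EnhancedState → ZMod 2) →ₗ[ZMod 2] (D.EnhancedState → ZMod 2) :=
  (D.cubeMatrix khovanovMaps).mulVecLin

variable (D) in
/-- The map `β` on the mod 2 Khovanov complex. -/
noncomputable def beta : (D.EnhancedState → ZMod 2) →ₗ[ZMod 2] (D.EnhancedState → ZMod 2) :=
  (D.cubeMatrix betaMaps).mulVecLin

lemma degrees_of_cubeMatrix_ne_zero {R : Type} [AddCommMonoid R] (P : PantsMaps R) (k : ℤ)
    (hm : ∀ a b c, P.mul a b c ≠ 0 → c.deg = a.deg + b.deg - 1 + k)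
    (hΔ : ∀ a b c, P.comul a b c ≠ 0 → b.deg + c.deg = a.deg - 1 + k)
    {S T : D.EnhancedState} (h : D.cubeMatrix P T S ≠ 0) :
    hDeg T = hDeg S + 1 ∧ qDeg T = qDeg S + k := by
  classical
  obtain ⟨c, -, hc⟩ := Finset.exists_ne_zero_of_sum_ne_zero h
  obtain ⟨s, a⟩ := S
  obtain ⟨t, b⟩ := T
  have hst : s c = false ∧ t = Function.update s c true := by
    by_contra h'
    exact hc (if_neg h')
  rw [if_pos hst] at hc
  obtain ⟨hs, rfl⟩ := hst
  have hsame := sameAwayFrom_update c s true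
  have hh : height (Function.update s c true) = height s + 1 := by
    have : Finset.univ.filter (fun c' => Function.update s c true c' = true) =
        insert c (Finset.univ.filter fun c' => s c' = true) := by
      ext c'
      by_cases h : c' = c
      · subst h; simp
      · simp [h]
    unfold height
    rw [this, Finset.card_insert_of_notMem (by simp [hs])]
    push_cast
    rfl
  have hq : ∑ C, (b C).deg = ∑ C, (a C).deg - 1 + k := by
    rw [edgeCoeff] at hc
    have hag : AgreeAwayFrom c (⟨s, a⟩ : D.EnhancedState) ⟨Function.update s c true, b⟩ := by
      by_contra h'
      exact hc (if_neg h')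
    rw [if_pos hag] at hc
    have hag' := (agreeAwayFrom_iff hsame).1 hag
    have hoff := sum_off hsame.symm (fun C => (b C).deg) (fun C => (a C).deg) fun C => by
      have := hag' C.1 C.2.1 C.2.2
      exact congrArg Label.deg this.symm
    rw [sum_circle c _ (fun C => (b C).deg), sum_circle c _ (fun C => (a C).deg), ← hoff]
    split_ifs at hc with h1 h2
    · rw [if_pos h1.2, if_neg h1.1]
      have := hm _ _ _ hc
      simp only [label] at this
      omega
    · rw [if_neg h2.2, if_pos h2.1]
      have := hΔ _ _ _ hc
      simp only [label] at this
      omega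
    · exact absurd rfl hc
  simp only [hDeg, qDeg, hh, hq]
  constructor <;> ring

lemma mulVecLin_mem_khChain (P : PantsMaps (ZMod 2)) (k : ℤ)
    (hm : ∀ a b c, P.mul a b c ≠ 0 → c.deg = a.deg + b.deg - 1 + k)
    (hΔ : ∀ a b c, P.comul a b c ≠ 0 → b.deg + c.deg = a.deg - 1 + k)
    {i j : ℤ} {v : D.EnhancedState → ZMod 2} (hv : v ∈ D.khChain i j) :
    (D.cubeMatrix P).mulVecLin v ∈ D.khChain (i + 1) (j + k) := by
  intro T hT
  obtain ⟨S, -, hS⟩ := Finset.exists_ne_zero_of_sum_ne_zero hT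
  obtain ⟨h1, h2⟩ := degrees_of_cubeMatrix_ne_zero P k hm hΔ (left_ne_zero_of_mul hS)
  obtain ⟨h3, h4⟩ := hv S (right_ne_zero_of_mul hS)
  exact ⟨by rw [h1, h3], by rw [h2, h4]⟩

lemma khovanovD_mem {i j : ℤ} {v : D.EnhancedState → ZMod 2} (hv : v ∈ D.khChain i j) :
    D.khovanovD v ∈ D.khChain (i + 1) j := by
  have := mulVecLin_mem_khChain khovanovMaps 0 (by decide) (by decide) hv
  rwa [add_zero] at this

lemma beta_mem {i j : ℤ} {v : D.EnhancedState → ZMod 2} (hv : v ∈ D.khChain i j) :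
    D.beta v ∈ D.khChain (i + 1) (j + 2) :=
  mulVecLin_mem_khChain betaMaps 2 (by decide) (by decide) hv

/-! #### The decomposition of Bar-Natan's differential -/

/-- The coefficient of `u ^ p` in an element of the Bar-Natan complex. -/
noncomputable def coeffVec (p : ℕ) (v : D.EnhancedState → Polynomial (ZMod 2)) :
    D.EnhancedState → ZMod 2 := fun S => (v S).coeff p

lemma cubeMatrix_barNatanMaps (T S : D.EnhancedState) : D.cubeMatrix barNatanMaps T S =
    Polynomial.C (D.cubeMatrix khovanovMaps T S) +
      Polynomial.X * Polynomial.C (D.cubeMatrix betaMaps T S) := by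
  classical
  simp only [cubeMatrix, map_sum, Finset.mul_sum, ← Finset.sum_add_distrib]
  refine Finset.sum_congr rfl fun c _ => ?_
  have hmul : ∀ a b c, barNatanMaps.mul a b c = Polynomial.C (khovanovMaps.mul a b c) +
      Polynomial.X * Polynomial.C (betaMaps.mul a b c) := by
    intro a b c
    cases a <;> cases b <;> cases c <;> simp [barNatanMaps, khovanovMaps, betaMaps]
  have hcomul : ∀ a b c, barNatanMaps.comul a b c = Polynomial.C (khovanovMaps.comul a b c) +
      Polynomial.X * Polynomial.C (betaMaps.comul a b c) := by
    intro a b c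
    cases a <;> cases b <;> cases c <;> simp [barNatanMaps, khovanovMaps, betaMaps]
  unfold edgeCoeff
  split_ifs <;> simp [hmul, hcomul]

lemma coeffVec_zero_barNatanD (v : D.EnhancedState → Polynomial (ZMod 2)) :
    coeffVec 0 (D.barNatanD v) = D.khovanovD (coeffVec 0 v) := by
  ext T
  change (∑ S, D.cubeMatrix barNatanMaps T S * v S).coeff 0 =
    ∑ S, D.cubeMatrix khovanovMaps T S * (v S).coeff 0
  rw [Polynomial.finsetSum_coeff]
  refine Finset.sum_congr rfl fun S _ => ?_
  rw [cubeMatrix_barNatanMaps, add_mul, mul_assoc, Polynomial.coeff_add, Polynomial.coeff_C_mul,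
    Polynomial.coeff_X_mul_zero, add_zero]

lemma coeffVec_succ_barNatanD (p : ℕ) (v : D.EnhancedState → Polynomial (ZMod 2)) :
    coeffVec (p + 1) (D.barNatanD v) =
      D.khovanovD (coeffVec (p + 1) v) + D.beta (coeffVec p v) := by
  ext T
  change (∑ S, D.cubeMatrix barNatanMaps T S * v S).coeff (p + 1) =
    ∑ S, D.cubeMatrix khovanovMaps T S * (v S).coeff (p + 1) +
      ∑ S, D.cubeMatrix betaMaps T S * (v S).coeff p
  rw [Polynomial.finsetSum_coeff, ← Finset.sum_add_distrib]
  refine Finset.sum_congr rfl fun S _ => ?_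
  rw [cubeMatrix_barNatanMaps, add_mul, mul_assoc, Polynomial.coeff_add, Polynomial.coeff_C_mul,
    Polynomial.coeff_X_mul, Polynomial.coeff_C_mul]

lemma coeffVec_C_zero (v : D.EnhancedState → ZMod 2) :
    coeffVec 0 (fun S => Polynomial.C (v S)) = v := by
  ext S; simp [coeffVec]

lemma coeffVec_C_succ (p : ℕ) (v : D.EnhancedState → ZMod 2) :
    coeffVec (p + 1) (fun S => Polynomial.C (v S)) = 0 := by
  ext S; simp [coeffVec]

lemma khovanovD_khovanovD (v : D.EnhancedState → ZMod 2) : D.khovanovD (D.khovanovD v) = 0 := by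
  have := congrArg (coeffVec 0) (D.barNatanD_barNatanD fun S => Polynomial.C (v S))
  rw [coeffVec_zero_barNatanD, coeffVec_zero_barNatanD, coeffVec_C_zero] at this
  exact this

lemma khovanovD_beta (v : D.EnhancedState → ZMod 2) :
    D.khovanovD (D.beta v) = D.beta (D.khovanovD v) := by
  have := congrArg (coeffVec 1) (D.barNatanD_barNatanD fun S => Polynomial.C (v S))
  rw [coeffVec_succ_barNatanD, coeffVec_succ_barNatanD, coeffVec_zero_barNatanD, coeffVec_C_zero,
    coeffVec_C_succ, map_zero, zero_add] at this
  have h0 : D.khovanovD (D.beta v) + D.beta (D.khovanovD v) = 0 := this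
  ext S
  have := congrFun h0 S
  simp only [Pi.add_apply, Pi.zero_apply] at this
  exact CharTwo.add_eq_zero.1 this

lemma mem_bnChain_iff {i j : ℤ} {v : D.EnhancedState → Polynomial (ZMod 2)} :
    v ∈ D.bnChain i j ↔ ∀ p : ℕ, coeffVec p v ∈ D.khChain i (j + 2 * p) := by
  constructor
  · intro h p S hS
    obtain ⟨h1, h2⟩ := h S p hS
    exact ⟨h1, by omega⟩
  · intro h S p hS
    obtain ⟨h1, h2⟩ := h p S hS
    exact ⟨h1, by omega⟩

lemma barNatanD_mem {i j : ℤ} {v : D.EnhancedState → Polynomial (ZMod 2)}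
    (hv : v ∈ D.bnChain i j) : D.barNatanD v ∈ D.bnChain (i + 1) j := by
  rw [mem_bnChain_iff] at hv ⊢
  rintro (_ | p)
  · rw [coeffVec_zero_barNatanD]
    exact khovanovD_mem (hv 0)
  · rw [coeffVec_succ_barNatanD]
    refine Submodule.add_mem _ (khovanovD_mem (hv _)) ?_
    have := beta_mem (hv p)
    rwa [show j + 2 * (p : ℤ) + 2 = j + 2 * ((p + 1 : ℕ) : ℤ) by push_cast; ring] at this

end LinkDiagram

/-! ### Homology, filtered complexes and their spectral sequences -/

section algebra

variable {K : Type} [CommRing K] {M : Type} [AddCommGroup M] [Module K M]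

/-- The quotient of the submodule `Z` by its intersection with `B`. -/
abbrev Subquotient (Z B : Submodule K M) : Type := ↥Z ⧸ B.submoduleOf Z

/-- The class in `Subquotient Z B` of an element of `Z`. -/
abbrev Subquotient.mk {Z : Submodule K M} (B : Submodule K M) : ↥Z →ₗ[K] Subquotient Z B :=
  (B.submoduleOf Z).mkQ

/-- The cocycles in degree `i` of the complex formed by submodules `C i` of `M` and the
differential `d`. -/
abbrev cocycles (d : M →ₗ[K] M) (C : ℤ → Submodule K M) (i : ℤ) : Submodule K M :=
  LinearMap.ker d ⊓ C i

/-- The cohomology in degree `i` of the complex formed by submodules `C i` of `M` and the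
differential `d`. -/
abbrev Cohomology (d : M →ₗ[K] M) (C : ℤ → Submodule K M) (i : ℤ) : Type :=
  Subquotient (cocycles d C i) ((C (i - 1)).map d)

end algebra

/-- A cochain complex of `K`-modules, given by submodules `deg i` of an ambient module, with a
decreasing filtration by subcomplexes: the `k`-th step of the filtration in degree `i` is
`fil k ⊓ deg i`. -/
structure FilteredComplex (K : Type) [CommRing K] where
  /-- the ambient module -/
  carrier : Type
  [addCommGroup : AddCommGroup carrier]
  [module : Module K carrier]
  /-- the differential -/
  d : carrier →ₗ[K] carrier
  /-- the term of degree `i` -/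
  deg : ℤ → Submodule K carrier
  /-- the filtration -/
  fil : ℤ → Submodule K carrier
  d_d : ∀ v, d (d v) = 0
  d_mem_deg : ∀ i, ∀ v ∈ deg i, d v ∈ deg (i + 1)
  fil_anti : Antitone fil
  d_mem_fil : ∀ k, ∀ v ∈ fil k, d v ∈ fil k

namespace FilteredComplex

attribute [instance] FilteredComplex.addCommGroup FilteredComplex.module

variable {K : Type} [CommRing K] (X : FilteredComplex K)

/-- The cohomology in degree `i`. -/
abbrev H (i : ℤ) : Type := Cohomology X.d X.deg i

/-- The induced filtration on the cohomology: the image of the cohomology of the `k`-th step of the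
filtration, that is the classes of the cocycles in the `k`-th step. -/
def filH (k i : ℤ) : Submodule K (X.H i) :=
  ((X.fil k).submoduleOf (cocycles X.d X.deg i)).map (Subquotient.mk _)

/-- The associated graded of the induced filtration on the cohomology. -/
abbrev grH (k i : ℤ) : Type := Subquotient (X.filH k i) (X.filH (k + 1) i)

/-- The module `Z_r^{k,l}` of elements of `F^k` in degree `k + l` whose differential lies in
`F^{k+r}`. -/
def Z (r k l : ℤ) : Submodule K X.carrier :=
  X.fil k ⊓ X.deg (k + l) ⊓ (X.fil (k + r)).comap X.d

/-- The submodule `Z_{r-1}^{k+1,l-1} + d Z_{r-1}^{k-r+1,l+r-2}`, by which one divides `Z_r^{k,l}` to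
get the entry `E_r^{k,l}` of the spectral sequence. -/
def B (r k l : ℤ) : Submodule K X.carrier :=
  X.Z (r - 1) (k + 1) (l - 1) ⊔ (X.Z (r - 1) (k - r + 1) (l + r - 2)).map X.d

open CategoryTheory in
/-- The data which exhibits `E` as the spectral sequence of the filtered complex `X`:
identifications `E_r^{k,l} = Z_r^{k,l} / (Z_{r-1}^{k+1,l-1} + d Z_{r-1}^{k-r+1,l+r-2})`, written as
surjections from `Z_r^{k,l}`, under which the differential `d_r` is induced by the differential of
`X`, and the isomorphism from the homology of the `r`-th page to the next page is induced by the
inclusion of `Z_{r+1}^{k,l}` in `Z_r^{k,l}`. -/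
structure Presentation (E : CohomologicalSpectralSequence (ModuleCat.{0} K) 0) where
  /-- the class in `E_r^{k,l}` of an element of `Z_r^{k,l}` -/
  π (r : ℤ) (hr : 0 ≤ r) (k l : ℤ) : X.Z r k l →ₗ[K] (E.page r hr).X (k, l)
  π_surjective (r : ℤ) (hr : 0 ≤ r) (k l : ℤ) : Function.Surjective (π r hr k l)
  ker_π (r : ℤ) (hr : 0 ≤ r) (k l : ℤ) :
    LinearMap.ker (π r hr k l) = (X.B r k l).submoduleOf (X.Z r k l)
  d_π (r : ℤ) (hr : 0 ≤ r) (k l : ℤ) (v : X.Z r k l) (w : X.Z r (k + r) (l + (1 - r)))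
    (hw : (w : X.carrier) = X.d v) :
    (E.page r hr).d (k, l) (k + r, l + (1 - r)) (π r hr k l v) = π r hr (k + r) (l + (1 - r)) w
  iso_π (r : ℤ) (hr : 0 ≤ r) (k l : ℤ) (v : X.Z r k l) (w : X.Z (r + 1) k l)
    (hw : (w : X.carrier) = v) (z : (E.page r hr).cycles (k, l))
    (hz : (E.page r hr).iCycles (k, l) z = π r hr k l v) :
    (E.iso r (r + 1) (k, l)).hom ((E.page r hr).homologyπ (k, l) z) =
      π (r + 1) (by lia) k l w

end FilteredComplex

/-! ### The homology theories -/

namespace LinkDiagram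

variable (D : LinkDiagram)

/-- Mod 2 Khovanov homology in homological grading `i` and `q`-grading `j`. -/
abbrev Kh (i j : ℤ) : Type := Cohomology D.khovanovD (fun i => D.khChain i j) i

/-- The class in Khovanov homology of a cocycle. -/
noncomputable abbrev khClass {i j : ℤ} (z : cocycles D.khovanovD (fun i => D.khChain i j) i) : D.Kh i j :=
  Subquotient.mk _ z

/-- The map `β_*` of bidegree `(1, 2)` induced by `β` on Khovanov homology. -/
noncomputable def betaStar {i j i' j' : ℤ} (hi : i' = i + 1) (hj : j' = j + 2) :
    D.Kh i j →ₗ[ZMod 2] D.Kh i' j' :=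
  Submodule.mapQ _ _
    (D.beta.restrict (p := cocycles D.khovanovD (fun i => D.khChain i j) i)
      (q := cocycles D.khovanovD (fun i => D.khChain i j') i') (by
        rintro v ⟨h1, h2⟩
        subst hi hj
        refine ⟨?_, beta_mem h2⟩
        change D.khovanovD (D.beta v) = 0
        rw [khovanovD_beta, show D.khovanovD v = 0 from h1, map_zero]))
    (by
      rintro ⟨_, _⟩ ⟨w, hw, rfl⟩
      subst hi hj
      refine ⟨D.beta w, ?_, khovanovD_beta w⟩
      have := beta_mem hw
      rwa [show i - 1 + 1 = i + 1 - 1 by ring] at this)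

/-- The secondary groups: the homology of Khovanov homology with respect to `β_*`. -/
abbrev KK (i j : ℤ) : Type :=
  Subquotient
    (LinearMap.ker (D.betaStar (rfl : i + 1 = i + 1) (rfl : j + 2 = j + 2)))
    (LinearMap.range (D.betaStar (i := i - 1) (j := j - 2) (i' := i) (j' := j)
      (by ring) (by ring)))

/-- Graded Bar-Natan homology in homological grading `i` and `q`-grading `j`. -/
abbrev BN (i j : ℤ) : Type :=
  Cohomology (D.barNatanD.restrictScalars (ZMod 2)) (fun i => D.bnChain i j) i

/-- The `u`-adic filtration of the Bar-Natan complex: the multiples of `u ^ k`, or everything if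
`k` is negative. -/
noncomputable def uFil (k : ℤ) : Submodule (ZMod 2) (D.EnhancedState → Polynomial (ZMod 2)) :=
  LinearMap.range ((LinearMap.lsmul (Polynomial (ZMod 2))
    (D.EnhancedState → Polynomial (ZMod 2)) (Polynomial.X ^ k.toNat)).restrictScalars (ZMod 2))

/-- The multiple by `u ^ k` of an element of the Khovanov complex, seen in the Bar-Natan complex, for
`k ≥ 0`. -/
noncomputable def uMultiple (k : ℤ) (z : D.EnhancedState → ZMod 2) :
    D.EnhancedState → Polynomial (ZMod 2) :=
  fun S => Polynomial.X ^ k.toNat * Polynomial.C (z S)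

/-- The Bar-Natan complex in `q`-grading `j` with its `u`-adic filtration. Its cohomology in degree
`i` is `D.BN i j`. -/
noncomputable def bnComplex (j : ℤ) : FilteredComplex (ZMod 2) where
  carrier := D.EnhancedState → Polynomial (ZMod 2)
  d := D.barNatanD.restrictScalars (ZMod 2)
  deg i := D.bnChain i j
  fil := D.uFil
  d_d := D.barNatanD_barNatanD
  d_mem_deg _ _ := barNatanD_mem
  fil_anti := by
    rintro k k' h _ ⟨w, rfl⟩
    refine ⟨(Polynomial.X ^ (k'.toNat - k.toNat) : Polynomial (ZMod 2)) • w, ?_⟩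
    change (Polynomial.X ^ k.toNat : Polynomial (ZMod 2)) • _ =
      (Polynomial.X ^ k'.toNat : Polynomial (ZMod 2)) • w
    rw [smul_smul, ← pow_add]
    congr 2
    omega
  d_mem_fil := by
    rintro k _ ⟨w, rfl⟩
    exact ⟨D.barNatanD w, (D.barNatanD.map_smul _ w).symm⟩

end LinkDiagram

/-!
The terms of the spectral sequence of a filtered complex are the subquotients
`E_r^{k,l} = Z_r^{k,l} / B_r^{k,l}`, with `d_r` induced by `d`. That the homology of `E_r` is
`E_{r+1}` comes down to two facts about elements: a class of `E_r` killed by `d_r` is represented by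
an element of `Z_{r+1}` (`FilteredComplex.toPageCycles_homologyπ_surjective`), and an element of
`Z_{r+1}` lies in `B_{r+1}` exactly when its class is a value of `d_r`
(`FilteredComplex.mem_B_succ_iff`). All isomorphisms below are obtained from two surjections with
the same source and the same kernel (`exists_linearEquiv_of_ker_eq`).

For the Bar-Natan complex in a fixed `q`-grading `j`, the power of `u` in front of an enhanced state
is determined by `j`, so only finitely many powers of `u` occur and the filtration is finite
(`LinkDiagram.exists_uFil_inf_bnChain`). Hence for large `r` the source or the target of `d_r`
vanishes, `Z_r^{k,l}` for `k ≥ 0` consists of the cocycles in `F^k`, and `E_r^{k,l}` is the associated graded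
group of the cohomology (`FilteredComplex.Presentation.exists_linearEquiv_grH`). A finite filtration
of a vector space splits (`nonempty_linearEquiv_directSum_gr`), which gives the direct sum.

The first two pages are read off from leading coefficients. Since `d = ∂ + u β`, the coefficient of
`u ^ k` in an element of `Z_1^{k,l}` is a cocycle of the Khovanov complex, and its class identifies
`E_1^{k,l}` with Khovanov homology (`LinkDiagram.leadingClass_surjective`,
`LinkDiagram.leadingClass_eq_zero_iff`). The coefficient of `u ^ (k + 1)` in `d v` is
`∂ v_{k+1} + β v_k`, so `d_1` is `β_*` (`LinkDiagram.leadingClass_barNatanD`). Then `E_2` is the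
homology of `β_*`, except that at `k = 0` it is the kernel, because `E_1^{-1,l}` vanishes.
-/

/-! ### Surjections and subquotients -/

/-- Two surjections with the same kernel have isomorphic targets, compatibly. -/
lemma exists_linearEquiv_of_ker_eq {K A X Y : Type} [Ring K] [AddCommGroup A] [Module K A]
    [AddCommGroup X] [Module K X] [AddCommGroup Y] [Module K Y] (f : A →ₗ[K] X) (g : A →ₗ[K] Y)
    (hf : Function.Surjective f) (hg : Function.Surjective g)
    (h : LinearMap.ker f = LinearMap.ker g) : ∃ e : X ≃ₗ[K] Y, ∀ a, e (f a) = g a := by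
  refine ⟨(f.quotKerEquivOfSurjective hf).symm ≪≫ₗ Submodule.quotEquivOfEq _ _ h ≪≫ₗ
    g.quotKerEquivOfSurjective hg, fun a => ?_⟩
  have : (f.quotKerEquivOfSurjective hf).symm (f a) = Submodule.Quotient.mk a :=
    (LinearEquiv.symm_apply_eq _).2 rfl
  simp only [LinearEquiv.trans_apply, this]
  rfl

lemma Subquotient.mk_eq_zero_iff {K M : Type} [CommRing K] [AddCommGroup M] [Module K M]
    {Z B : Submodule K M} (z : Z) : Subquotient.mk B z = 0 ↔ (z : M) ∈ B :=
  Submodule.Quotient.mk_eq_zero _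

lemma Subquotient.mk_surjective {K M : Type} [CommRing K] [AddCommGroup M] [Module K M]
    {Z : Submodule K M} (B : Submodule K M) : Function.Surjective (Subquotient.mk (Z := Z) B) :=
  Submodule.mkQ_surjective _

/-! ### The spectral sequence of a filtered complex -/

namespace FilteredComplex

open CategoryTheory

variable {K : Type} [CommRing K] (X : FilteredComplex K)

variable {X} in
lemma mem_Z {r k l : ℤ} {v : X.carrier} :
    v ∈ X.Z r k l ↔ v ∈ X.fil k ∧ v ∈ X.deg (k + l) ∧ X.d v ∈ X.fil (k + r) := by
  simp [Z, and_assoc]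

variable {X} in
lemma mem_B {r k l : ℤ} {v : X.carrier} :
    v ∈ X.B r k l ↔ ∃ a b, (a ∈ X.fil (k + 1) ∧ a ∈ X.deg (k + l) ∧ X.d a ∈ X.fil (k + r)) ∧
      (b ∈ X.fil (k - r + 1) ∧ b ∈ X.deg (k + l - 1) ∧ X.d b ∈ X.fil k) ∧ v = a + X.d b := by
  simp only [B, Submodule.mem_sup, Submodule.mem_map, mem_Z,
    show k + 1 + (l - 1) = k + l by ring, show k + 1 + (r - 1) = k + r by ring,
    show k - r + 1 + (l + r - 2) = k + l - 1 by ring, show k - r + 1 + (r - 1) = k by ring]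
  constructor
  · rintro ⟨a, ha, _, ⟨b, hb, rfl⟩, rfl⟩
    exact ⟨a, b, ha, hb, rfl⟩
  · rintro ⟨a, b, ha, hb, rfl⟩
    exact ⟨a, ha, _, ⟨b, hb, rfl⟩, rfl⟩

lemma d_mem_Z {r k l k' l' : ℤ} (hk : k + r = k') (hl : l + (1 - r) = l') {v : X.carrier}
    (hv : v ∈ X.Z r k l) : X.d v ∈ X.Z r k' l' := by
  subst hk hl
  rw [mem_Z] at hv ⊢
  refine ⟨hv.2.2, ?_, by rw [X.d_d]; exact Submodule.zero_mem _⟩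
  have := X.d_mem_deg _ _ hv.2.1
  rwa [show k + l + 1 = k + r + (l + (1 - r)) by ring] at this

lemma d_mem_B {r k l k' l' : ℤ} (hk : k + r = k') (hl : l + (1 - r) = l') {v : X.carrier}
    (hv : v ∈ X.B r k l) : X.d v ∈ X.B r k' l' := by
  subst hk hl
  rw [mem_B] at hv ⊢
  obtain ⟨a, b, ha, hb, rfl⟩ := hv
  refine ⟨0, a, ⟨Submodule.zero_mem _, Submodule.zero_mem _, by simp⟩, ?_, by
    rw [map_add, X.d_d, add_zero, zero_add]⟩
  rwa [show k + r - r + 1 = k + 1 by ring,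
    show k + r + (l + (1 - r)) - 1 = k + l by ring]

/-- The entry `E_r^{k,l}` of the spectral sequence. -/
abbrev Entry (r k l : ℤ) : Type := Subquotient (X.Z r k l) (X.B r k l)

/-- The differential `d_r` from `E_r^{k,l}` to `E_r^{k',l'}`, where `(k', l') = (k + r, l + 1 - r)`.
The target is given by equations, so that indices need not have this shape syntactically. -/
def entryD {r k l k' l' : ℤ} (hk : k + r = k') (hl : l + (1 - r) = l') :
    X.Entry r k l →ₗ[K] X.Entry r k' l' :=
  Submodule.mapQ _ _ (X.d.restrict fun _ => X.d_mem_Z hk hl) fun _ h => X.d_mem_B hk hl h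

open Classical in
/-- The `r`-th page of the spectral sequence. -/
noncomputable def page (r : ℤ) :
    HomologicalComplex (ModuleCat.{0} K) (ComplexShape.up' (⟨r, 1 - r⟩ : ℤ × ℤ)) where
  X p := ModuleCat.of K (X.Entry r p.1 p.2)
  d p q := if h : p.1 + r = q.1 ∧ p.2 + (1 - r) = q.2 then
    ModuleCat.ofHom (X.entryD h.1 h.2) else 0
  shape p q h := dif_neg fun h' => h (Prod.ext h'.1 h'.2)
  d_comp_d' p q s hpq hqs := by
    obtain rfl : _ = q := hpq
    obtain rfl : _ = s := hqs
    rw [dif_pos ⟨rfl, rfl⟩, dif_pos ⟨rfl, rfl⟩, ← ModuleCat.ofHom_comp]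
    ext v
    change Submodule.Quotient.mk (⟨X.d (X.d v), _⟩ : X.Z r _ _) = 0
    simp only [X.d_d]
    rfl

/-- The class in `E_r^{k,l}` of an element of `Z_r^{k,l}`. -/
noncomputable def pageπ (r k l : ℤ) : X.Z r k l →ₗ[K] (X.page r).X (k, l) :=
  Subquotient.mk (X.B r k l)

lemma pageπ_surjective (r k l : ℤ) : Function.Surjective (X.pageπ r k l) :=
  Submodule.mkQ_surjective _

lemma ker_pageπ (r k l : ℤ) :
    LinearMap.ker (X.pageπ r k l) = (X.B r k l).submoduleOf (X.Z r k l) :=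
  Submodule.ker_mkQ _

lemma pageπ_eq_zero_iff {r k l : ℤ} (v : X.Z r k l) :
    X.pageπ r k l v = 0 ↔ (v : X.carrier) ∈ X.B r k l := by
  rw [← LinearMap.mem_ker, ker_pageπ]
  rfl

lemma page_d_pageπ {r k l k' l' : ℤ} (hk : k + r = k') (hl : l + (1 - r) = l')
    (v : X.Z r k l) (w : X.Z r k' l') (hw : (w : X.carrier) = X.d v) :
    (X.page r).d (k, l) (k', l') (X.pageπ r k l v) = X.pageπ r k' l' w := by
  obtain rfl : w = ⟨X.d v, X.d_mem_Z hk hl v.2⟩ := Subtype.ext hw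
  have : (X.page r).d (k, l) (k', l') = ModuleCat.ofHom (X.entryD hk hl) := dif_pos ⟨hk, hl⟩
  rw [this]
  rfl

lemma Z_succ_le (r k l : ℤ) : X.Z (r + 1) k l ≤ X.Z r k l := fun v hv => by
  rw [mem_Z] at hv ⊢
  exact ⟨hv.1, hv.2.1, X.fil_anti (by lia) hv.2.2⟩

/-- An element of `Z_{r+1}^{k,l}` as a cycle of the `r`-th page. -/
noncomputable def toPageCycles (r k l : ℤ) :
    ModuleCat.of K (X.Z (r + 1) k l) ⟶ (X.page r).cycles (k, l) :=
  (X.page r).liftCycles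
    (ModuleCat.ofHom (X.pageπ r k l ∘ₗ Submodule.inclusion (X.Z_succ_le r k l)))
    (k + r, l + (1 - r)) (ComplexShape.next_eq' _ rfl) (by
      ext v
      have hv := mem_Z.1 v.2
      have h := X.d_mem_Z rfl rfl (X.Z_succ_le r k l v.2)
      refine (X.page_d_pageπ rfl rfl _ ⟨_, h⟩ rfl).trans ?_
      refine (X.pageπ_eq_zero_iff _).2 (mem_B.2 ?_)
      refine ⟨X.d v, 0, ⟨?_, (mem_Z.1 h).2.1, (mem_Z.1 h).2.2⟩,
        ⟨Submodule.zero_mem _, Submodule.zero_mem _, by simp⟩, by simp⟩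
      rw [add_assoc]
      exact hv.2.2)

lemma iCycles_toPageCycles (r k l : ℤ) (v : X.Z (r + 1) k l) :
    (X.page r).iCycles (k, l) (X.toPageCycles r k l v) =
      X.pageπ r k l (Submodule.inclusion (X.Z_succ_le r k l) v) := by
  have := (X.page r).liftCycles_i
    (ModuleCat.ofHom (X.pageπ r k l ∘ₗ Submodule.inclusion (X.Z_succ_le r k l)))
    (k + r, l + (1 - r)) (ComplexShape.next_eq' _ rfl)
  exact congrArg (fun f => f.hom v) (this _)

lemma iCycles_injective (r k l : ℤ) : Function.Injective ((X.page r).iCycles (k, l)) :=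
  (ModuleCat.mono_iff_injective _).1 inferInstance

/-- Every cycle of `E_r` is the class of an element of `Z_{r+1}`: if `d v` lies in `B_r`, then `v`
can be corrected by an element of `Z_{r-1}^{k+1,l-1}`, which does not change its class. -/
lemma toPageCycles_homologyπ_surjective (r k l : ℤ) : Function.Surjective
    (X.toPageCycles r k l ≫ (X.page r).homologyπ (k, l)).hom := by
  intro ξ
  obtain ⟨z, rfl⟩ := (ModuleCat.epi_iff_surjective ((X.page r).homologyπ (k, l))).1 inferInstance ξ
  obtain ⟨v, hv⟩ := X.pageπ_surjective r k l ((X.page r).iCycles (k, l) z)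
  have hd : (X.page r).d (k, l) (k + r, l + (1 - r)) (X.pageπ r k l v) = 0 := by
    rw [hv]
    exact congrArg (fun f => f.hom z) ((X.page r).iCycles_d (k, l) (k + r, l + (1 - r)))
  rw [X.page_d_pageπ rfl rfl v ⟨_, X.d_mem_Z rfl rfl v.2⟩ rfl, pageπ_eq_zero_iff, mem_B] at hd
  obtain ⟨a, b, ha, hb, hab⟩ := hd
  rw [show k + r - r + 1 = k + 1 by ring, show k + r + (l + (1 - r)) - 1 = k + l by ring] at hb
  have hv' := mem_Z.1 v.2
  have hw : (v : X.carrier) - b ∈ X.Z (r + 1) k l := by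
    rw [mem_Z]
    refine ⟨Submodule.sub_mem _ hv'.1 (X.fil_anti (by lia) hb.1),
      Submodule.sub_mem _ hv'.2.1 hb.2.1, ?_⟩
    rw [map_sub, sub_eq_of_eq_add hab, ← add_assoc]
    exact ha.1
  refine ⟨⟨_, hw⟩, ?_⟩
  refine congrArg ((X.page r).homologyπ (k, l)) (X.iCycles_injective r k l ?_)
  rw [← hv, ← sub_eq_zero]
  refine (congrArg (· - _) (X.iCycles_toPageCycles r k l ⟨_, hw⟩)).trans ?_
  rw [← map_sub, pageπ_eq_zero_iff, mem_B]
  refine ⟨-b, 0, ⟨Submodule.neg_mem _ hb.1, Submodule.neg_mem _ hb.2.1, ?_⟩,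
    ⟨Submodule.zero_mem _, Submodule.zero_mem _, by simp⟩, by simp⟩
  rw [map_neg]
  exact Submodule.neg_mem _ hb.2.2

/-- A cycle of the `r`-th page is homologous to zero if and only if it is a value of `d_r`. -/
lemma homologyπ_eq_zero_iff (r k l : ℤ) (z : (X.page r).cycles (k, l)) :
    (X.page r).homologyπ (k, l) z = 0 ↔ ∃ y : X.Z r (k - r) (l - (1 - r)),
      (X.page r).iCycles (k, l) z = (X.page r).d (k - r, l - (1 - r)) (k, l) (X.pageπ _ _ _ y) := by
  have hprev : (ComplexShape.up' (⟨r, 1 - r⟩ : ℤ × ℤ)).prev (k, l) = (k - r, l - (1 - r)) :=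
    ComplexShape.prev_eq' _ (by change (k - r + r, l - (1 - r) + (1 - r)) = (k, l); simp)
  have ex := ShortComplex.exact_of_g_is_cokernel
    (ShortComplex.mk _ _ ((X.page r).toCycles_comp_homologyπ (k - r, l - (1 - r)) (k, l)))
    ((X.page r).homologyIsCokernel _ _ hprev)
  rw [ShortComplex.moduleCat_exact_iff] at ex
  have hi := (X.page r).toCycles_i (k - r, l - (1 - r)) (k, l)
  constructor
  · intro h
    obtain ⟨x, rfl⟩ := ex z h
    obtain ⟨y, rfl⟩ := X.pageπ_surjective _ _ _ x
    exact ⟨y, congrArg (fun f => f.hom (X.pageπ _ _ _ y)) hi⟩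
  · rintro ⟨y, hy⟩
    have : z = (X.page r).toCycles (k - r, l - (1 - r)) (k, l) (X.pageπ _ _ _ y) :=
      X.iCycles_injective r k l (hy.trans (congrArg (fun f => f.hom (X.pageπ _ _ _ y)) hi).symm)
    rw [this]
    exact congrArg (fun f => f.hom (X.pageπ _ _ _ y))
      ((X.page r).toCycles_comp_homologyπ (k - r, l - (1 - r)) (k, l))

/-- An element of `Z_{r+1}^{k,l}` dies on the page `E_{r+1}` if and only if its class on the page
`E_r` is a value of `d_r`. -/
lemma mem_B_succ_iff {r k l k₀ l₀ : ℤ} (hk : k₀ + r = k) (hl : l₀ + (1 - r) = l) {w : X.carrier}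
    (hw : w ∈ X.Z (r + 1) k l) :
    w ∈ X.B (r + 1) k l ↔ ∃ y ∈ X.Z r k₀ l₀, w - X.d y ∈ X.B r k l := by
  subst hk hl
  have hw' := mem_Z.1 hw
  simp only [mem_B, mem_Z]
  have e0 : k₀ + r + (l₀ + (1 - r)) - 1 = k₀ + l₀ := by ring
  have e1 : k₀ + r - (r + 1) + 1 = k₀ := by ring
  rw [e0, e1]
  constructor
  · rintro ⟨a, y, ha, hy, h⟩
    refine ⟨y, hy, a, 0, ⟨ha.1, ha.2.1, X.fil_anti (by lia) ha.2.2⟩,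
      ⟨Submodule.zero_mem _, Submodule.zero_mem _, by simp⟩, ?_⟩
    rw [h, map_zero, add_zero, add_sub_cancel_right]
  · rintro ⟨y, hy, a, b, ha, hb, h⟩
    have hwe : w = a + X.d (y + b) := by
      rw [map_add, sub_eq_iff_eq_add.1 h]
      abel
    refine ⟨a, y + b, ⟨ha.1, ha.2.1, ?_⟩, ⟨?_, Submodule.add_mem _ hy.2.1 hb.2.1, ?_⟩, hwe⟩
    · rw [eq_sub_of_add_eq hwe.symm, map_sub, X.d_d, sub_zero]
      exact hw'.2.2
    · exact Submodule.add_mem _ hy.1 (X.fil_anti (by lia) hb.1)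
    · rw [map_add]
      exact Submodule.add_mem _ hy.2.2 hb.2.2

lemma ker_toPageCycles_homologyπ (r k l : ℤ) :
    LinearMap.ker (X.toPageCycles r k l ≫ (X.page r).homologyπ (k, l)).hom =
      LinearMap.ker (X.pageπ (r + 1) k l) := by
  ext w
  rw [LinearMap.mem_ker, LinearMap.mem_ker, pageπ_eq_zero_iff,
    X.mem_B_succ_iff (sub_add_cancel k r) (sub_add_cancel l (1 - r)) w.2]
  refine (X.homologyπ_eq_zero_iff r k l _).trans ?_
  have key : ∀ y : X.Z r (k - r) (l - (1 - r)),
      (X.page r).iCycles (k, l) (X.toPageCycles r k l w) =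
        (X.page r).d (k - r, l - (1 - r)) (k, l) (X.pageπ _ _ _ y) ↔
      (w : X.carrier) - X.d y ∈ X.B r k l := fun y => by
    rw [X.page_d_pageπ (sub_add_cancel k r) (sub_add_cancel l (1 - r)) y
      ⟨_, X.d_mem_Z (sub_add_cancel k r) (sub_add_cancel l (1 - r)) y.2⟩ rfl,
      iCycles_toPageCycles, ← sub_eq_zero, ← map_sub, pageπ_eq_zero_iff]
    rfl
  exact ⟨fun ⟨y, h⟩ => ⟨y, y.2, (key y).1 h⟩, fun ⟨y, hy, h⟩ => ⟨⟨y, hy⟩, (key ⟨y, hy⟩).2 h⟩⟩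

lemma exists_pageIso (r k l : ℤ) :
    ∃ e : (X.page r).homology (k, l) ≃ₗ[K] (X.page (r + 1)).X (k, l),
      ∀ w, e ((X.toPageCycles r k l ≫ (X.page r).homologyπ (k, l)).hom w) = X.pageπ (r + 1) k l w :=
  exists_linearEquiv_of_ker_eq _ _ (X.toPageCycles_homologyπ_surjective r k l)
    (X.pageπ_surjective _ _ _) (X.ker_toPageCycles_homologyπ r k l)

/-- The isomorphism from the homology of the `r`-th page to the next page. -/
noncomputable def pageIso (r k l : ℤ) :
    (X.page r).homology (k, l) ≅ (X.page (r + 1)).X (k, l) :=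
  (X.exists_pageIso r k l).choose.toModuleIso

/-- The spectral sequence of a filtered complex, from the page `E_0` on. -/
noncomputable def spectralSequence : CohomologicalSpectralSequence (ModuleCat.{0} K) 0 where
  page r _ := X.page r
  iso r r' pq h _ := by
    subst h
    exact X.pageIso r pq.1 pq.2

/-- The pages are the quotients `Z_r / B_r` by construction, and the isomorphisms from the homology
of a page to the next page were chosen compatibly with these quotients. -/
noncomputable def presentation : X.Presentation X.spectralSequence where
  π r _ k l := X.pageπ r k l
  π_surjective r _ k l := X.pageπ_surjective r k l
  ker_π r _ k l := X.ker_pageπ r k l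
  d_π r _ k l v w hw := X.page_d_pageπ rfl rfl v w hw
  iso_π r _ k l v w hw z hz := by
    have : z = X.toPageCycles r k l w := X.iCycles_injective r k l (by
      rw [iCycles_toPageCycles]
      exact hz.trans (congrArg _ (Subtype.ext hw.symm)))
    subst this
    exact (X.exists_pageIso r k l).choose_spec w

end FilteredComplex

/-! ### Convergence for a finite filtration -/

/-- A finite filtration of a vector space splits: linear sections of the projections to the graded
pieces add up to an isomorphism, injective by looking at the lowest nonzero component and surjective
by descending induction along the filtration. -/
lemma nonempty_linearEquiv_directSum_gr {K V : Type} [Field K] [AddCommGroup V] [Module K V]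
    (F : ℤ → Submodule K V) (hF : Antitone F) (h0 : F 0 = ⊤) {N : ℤ} (hN : F N = ⊥) :
    Nonempty (V ≃ₗ[K] DirectSum ℤ fun k => Subquotient (F k) (F (k + 1))) := by
  classical
  have hs : ∀ k, ∃ s : Subquotient (F k) (F (k + 1)) →ₗ[K] F k,
      Subquotient.mk (F (k + 1)) ∘ₗ s = LinearMap.id := fun k =>
    LinearMap.exists_rightInverse_of_surjective _
      (LinearMap.range_eq_top.2 (Submodule.mkQ_surjective _))
  choose s hs using hs
  have hs' : ∀ k x, Subquotient.mk (F (k + 1)) (s k x) = x := fun k x =>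
    LinearMap.congr_fun (hs k) x
  let Φ : (DirectSum ℤ fun k => Subquotient (F k) (F (k + 1))) →ₗ[K] V :=
    DirectSum.toModule K ℤ V fun k => (F k).subtype ∘ₗ s k
  have hΦ : ∀ k x, Φ (DirectSum.lof K ℤ _ k x) = s k x := fun k x => by
    simp only [Φ, DirectSum.toModule_lof]
    rfl
  refine ⟨(LinearEquiv.ofBijective Φ ⟨?_, ?_⟩).symm⟩
  · rw [injective_iff_map_eq_zero]
    intro x hx
    by_contra hne
    have hsupp : (DFinsupp.support x).Nonempty := by
      rw [Finset.nonempty_iff_ne_empty]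
      exact fun h => hne (DFinsupp.support_eq_empty.1 h)
    -- the lowest component of `x` is the leading term of `Φ x`
    set m := (DFinsupp.support x).min' hsupp with hm
    have hmem : m ∈ DFinsupp.support x := Finset.min'_mem _ _
    have hsum : Φ x = ∑ k ∈ DFinsupp.support x, (s k (x k) : V) := by
      conv_lhs => rw [← DirectSum.sum_support_of x]
      rw [map_sum]
      exact Finset.sum_congr rfl fun k _ => hΦ k _
    rw [← Finset.add_sum_erase _ _ hmem, hx] at hsum
    have hrest : ∑ k ∈ (DFinsupp.support x).erase m, (s k (x k) : V) ∈ F (m + 1) := by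
      refine Submodule.sum_mem _ fun k hk => hF ?_ (s k (x k)).2
      have h1 := Finset.min'_le _ _ (Finset.mem_of_mem_erase hk)
      have h2 := Finset.ne_of_mem_erase hk
      rw [← hm] at h1
      lia
    have : (s m (x m) : V) ∈ F (m + 1) := by
      rw [eq_neg_of_add_eq_zero_left hsum.symm]
      exact Submodule.neg_mem _ hrest
    rw [← Subquotient.mk_eq_zero_iff, hs'] at this
    exact DFinsupp.mem_support_iff.1 hmem this
  · rw [← LinearMap.range_eq_top, ← top_le_iff]
    have step : ∀ k, F (k + 1) ≤ LinearMap.range Φ → F k ≤ LinearMap.range Φ := by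
      intro k h v hv
      set ξ := Subquotient.mk (F (k + 1)) ⟨v, hv⟩ with hξ
      have h1 : v - s k ξ ∈ F (k + 1) :=
        (Subquotient.mk_eq_zero_iff (⟨v, hv⟩ - s k ξ)).1 (by rw [map_sub, hs', hξ, sub_self])
      rw [← sub_add_cancel v (s k ξ : V)]
      exact Submodule.add_mem _ (h h1) ⟨_, hΦ k ξ⟩
    have hd : ∀ n : ℕ, F (N - n) ≤ LinearMap.range Φ := by
      intro n
      induction n with
      | zero => simp [hN]
      | succ n ih =>
        refine step _ ?_
        rwa [show N - ((n + 1 : ℕ) : ℤ) + 1 = N - n by push_cast; ring]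
    rw [← h0]
    exact (hF (by lia)).trans (hd N.toNat)

namespace FilteredComplex

open CategoryTheory

variable {K : Type} [CommRing K] {X : FilteredComplex K}

lemma mk_eq_zero_iff {i : ℤ} (z : cocycles X.d X.deg i) :
    (Subquotient.mk _ z : X.H i) = 0 ↔ ∃ b ∈ X.deg (i - 1), X.d b = z :=
  Subquotient.mk_eq_zero_iff _

lemma mk_mem_filH_iff {k i : ℤ} (z : cocycles X.d X.deg i) :
    (Subquotient.mk _ z : X.H i) ∈ X.filH k i ↔
      ∃ b ∈ X.deg (i - 1), (z : X.carrier) - X.d b ∈ X.fil k := by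
  constructor
  · rintro ⟨y, hy, hyz⟩
    rw [← sub_eq_zero, ← map_sub, mk_eq_zero_iff] at hyz
    obtain ⟨b, hb, hbe⟩ := hyz
    refine ⟨-b, Submodule.neg_mem _ hb, ?_⟩
    rw [map_neg, hbe]
    change (z : X.carrier) - -((y : X.carrier) - z) ∈ X.fil k
    rw [neg_sub, sub_sub_cancel]
    exact hy
  · rintro ⟨b, hb, h⟩
    have hdb : X.d b ∈ cocycles X.d X.deg i := ⟨X.d_d b, by
      have := X.d_mem_deg _ _ hb
      rwa [sub_add_cancel] at this⟩
    refine ⟨z - ⟨X.d b, hdb⟩, h, ?_⟩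
    rw [map_sub, sub_eq_self, mk_eq_zero_iff]
    exact ⟨b, hb, rfl⟩

lemma filH_antitone (i : ℤ) : Antitone fun k => X.filH k i := fun _ _ h =>
  Submodule.map_mono fun _ hz => X.fil_anti h hz

lemma filH_eq_top {k : ℤ} (hk : X.fil k = ⊤) (i : ℤ) : X.filH k i = ⊤ := by
  rw [eq_top_iff]
  rintro ξ -
  obtain ⟨z, rfl⟩ := Subquotient.mk_surjective _ ξ
  exact ⟨z, by change (z : X.carrier) ∈ X.fil k; rw [hk]; trivial, rfl⟩

lemma filH_eq_bot {k i : ℤ} (hk : ∀ v ∈ X.fil k, v ∈ X.deg i → v = 0) : X.filH k i = ⊥ := by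
  rw [eq_bot_iff]
  rintro _ ⟨z, hz, rfl⟩
  have : z = 0 := Subtype.ext (hk z hz z.2.2)
  rw [this, map_zero]
  exact Submodule.zero_mem _

namespace Presentation

variable {E : CohomologicalSpectralSequence (ModuleCat.{0} K) 0}

lemma π_eq_zero_iff (P : X.Presentation E) {r : ℤ} (hr : 0 ≤ r) {k l : ℤ} (v : X.Z r k l) :
    P.π r hr k l v = 0 ↔ (v : X.carrier) ∈ X.B r k l := by
  rw [← LinearMap.mem_ker, P.ker_π]
  rfl

lemma d_π_of_eq (P : X.Presentation E) {r : ℤ} (hr : 0 ≤ r) {k l k' l' : ℤ}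
    (hk : k + r = k') (hl : l + (1 - r) = l')
    (v : X.Z r k l) (w : X.Z r k' l') (hw : (w : X.carrier) = X.d v) :
    (E.page r hr).d (k, l) (k', l') (P.π r hr k l v) = P.π r hr k' l' w := by
  subst hk hl
  exact P.d_π r hr k l v w hw

/-- If `F^{k+1}` is everything, then `Z_r^{k,l}` equals `Z_{r-1}^{k+1,l-1}`, which is divided
out. -/
lemma subsingleton_X (P : X.Presentation E) {r : ℤ} (hr : 0 ≤ r) {k : ℤ}
    (hk : X.fil (k + 1) = ⊤) (l : ℤ) :
    Subsingleton ((E.page r hr).X (k, l)) := by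
  refine subsingleton_of_forall_eq 0 fun ξ => ?_
  obtain ⟨v, rfl⟩ := P.π_surjective r hr k l ξ
  have hv := mem_Z.1 v.2
  rw [π_eq_zero_iff, mem_B]
  exact ⟨v, 0, ⟨by rw [hk]; trivial, hv.2.1, hv.2.2⟩,
    ⟨Submodule.zero_mem _, Submodule.zero_mem _, by simp⟩, by simp⟩

/-- For `r` at least the length of the filtration, the source of `d_r` vanishes if `k < 0` and its
target vanishes if `k ≥ 0`. -/
lemma page_d_eq_zero (P : X.Presentation E) (h0 : ∀ k ≤ 0, X.fil k = ⊤) {N : ℤ}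
    (hN : ∀ k ≥ N, ∀ i, ∀ v ∈ X.fil k, v ∈ X.deg i → v = 0) {r : ℤ} (hr : 0 ≤ r) (hNr : N ≤ r)
    (p q : ℤ × ℤ) : (E.page r hr).d p q = 0 := by
  by_cases hpq : (ComplexShape.up' (⟨r, 1 - r⟩ : ℤ × ℤ)).Rel p q
  swap
  · exact (E.page r hr).shape _ _ hpq
  obtain rfl : _ = q := hpq
  obtain ⟨k, l⟩ := p
  ext ξ
  obtain ⟨v, rfl⟩ := P.π_surjective r hr k l ξ
  rcases lt_or_ge k 0 with hk | hk
  · have := P.subsingleton_X hr (h0 (k + 1) (by lia)) l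
    rw [Subsingleton.elim (P.π r hr k l v) 0, map_zero, map_zero]
  · have hd := X.d_mem_Z rfl rfl v.2
    have hd' := mem_Z.1 hd
    refine (P.d_π r hr k l v ⟨_, hd⟩ rfl).trans ?_
    have : (⟨_, hd⟩ : X.Z r (k + r) (l + (1 - r))) = 0 :=
      Subtype.ext (hN (k + r) (by lia) _ _ hd'.1 hd'.2.1)
    rw [this, map_zero]
    rfl

/-- For `r` at least the length of the filtration and `k ≥ 0`, the elements of `Z_r^{k,l}` are the
cocycles in `F^k`, and two of them agree modulo `B_r^{k,l}` if and only if their cohomology classes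
agree modulo `F^{k+1}`. -/
lemma exists_linearEquiv_grH (P : X.Presentation E) (h0 : ∀ k ≤ 0, X.fil k = ⊤) {N : ℤ}
    (hN : ∀ k ≥ N, ∀ i, ∀ v ∈ X.fil k, v ∈ X.deg i → v = 0) {r : ℤ} (hr : 0 ≤ r) (hNr : N ≤ r)
    (k l : ℤ) : ∃ e : (E.page r hr).X (k, l) ≃ₗ[K] X.grH k (k + l),
      ∀ (v : X.Z r k l) (z : cocycles X.d X.deg (k + l)) (y : X.filH k (k + l)),
        (z : X.carrier) = v → (y : X.H (k + l)) = Subquotient.mk _ z →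
        e (P.π r hr k l v) = Subquotient.mk _ y := by
  rcases lt_or_ge k 0 with hk | hk
  · have h1 := P.subsingleton_X hr (h0 (k + 1) (by lia)) l
    have h2 : Subsingleton (X.grH k (k + l)) := by
      refine subsingleton_of_forall_eq 0 fun ξ => ?_
      obtain ⟨y, rfl⟩ := Subquotient.mk_surjective _ ξ
      rw [Subquotient.mk_eq_zero_iff, filH_eq_top (h0 (k + 1) (by lia))]
      trivial
    exact ⟨⟨0, 0, fun _ => Subsingleton.elim _ _, fun _ => Subsingleton.elim _ _⟩,
      fun _ _ _ _ _ => Subsingleton.elim _ _⟩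
  have hle : X.Z r k l ≤ cocycles X.d X.deg (k + l) := fun v hv => by
    have hv' := mem_Z.1 hv
    exact ⟨hN (k + r) (by lia) _ _ hv'.2.2 (X.d_mem_deg _ _ hv'.2.1), hv'.2.1⟩
  let f : X.Z r k l →ₗ[K] X.grH k (k + l) := Subquotient.mk _ ∘ₗ
    LinearMap.codRestrict (X.filH k (k + l)) (Subquotient.mk _ ∘ₗ Submodule.inclusion hle)
      fun v => ⟨Submodule.inclusion hle v, (mem_Z.1 v.2).1, rfl⟩
  have hf : Function.Surjective f := by
    intro ξ
    obtain ⟨⟨_, z, hz, rfl⟩, rfl⟩ := Subquotient.mk_surjective _ ξ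
    refine ⟨⟨z, mem_Z.2 ⟨hz, z.2.2, ?_⟩⟩, rfl⟩
    rw [show X.d z = 0 from z.2.1]
    exact Submodule.zero_mem _
  obtain ⟨e, he⟩ := exists_linearEquiv_of_ker_eq (P.π r hr k l) f (P.π_surjective r hr k l) hf (by
    ext v
    have hv := mem_Z.1 v.2
    have hdv : X.d v = 0 := (hle v.2).1
    rw [LinearMap.mem_ker, LinearMap.mem_ker, π_eq_zero_iff]
    have : f v = 0 ↔ (Subquotient.mk _ (Submodule.inclusion hle v) : X.H (k + l)) ∈
        X.filH (k + 1) (k + l) := Subquotient.mk_eq_zero_iff _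
    rw [this, mk_mem_filH_iff, mem_B]
    constructor
    · rintro ⟨a, b, ha, hb, h⟩
      refine ⟨b, hb.2.1, ?_⟩
      change (v : X.carrier) - X.d b ∈ _
      rw [h, add_sub_cancel_right]
      exact ha.1
    · rintro ⟨b, hb, h⟩
      replace h : (v : X.carrier) - X.d b ∈ X.fil (k + 1) := h
      -- for `k < r` the element `b` is in `F^{k-r+1}`, which is everything; for `k ≥ r`, `v = 0`
      rcases lt_or_ge k r with hkr | hkr
      · have hdb : X.d b ∈ X.deg (k + l) := by
          have := X.d_mem_deg _ _ hb
          rwa [sub_add_cancel] at this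
        refine ⟨v - X.d b, b, ⟨h, Submodule.sub_mem _ hv.2.1 hdb, ?_⟩,
          ⟨by rw [h0 _ (by lia)]; trivial, hb, ?_⟩, by abel⟩
        · rw [map_sub, X.d_d, hdv, sub_zero]
          exact Submodule.zero_mem _
        · rw [← sub_sub_cancel (v : X.carrier) (X.d b)]
          exact Submodule.sub_mem _ hv.1 (X.fil_anti (by lia) h)
      · refine ⟨0, 0, ⟨Submodule.zero_mem _, Submodule.zero_mem _, by simp⟩,
          ⟨Submodule.zero_mem _, Submodule.zero_mem _, by simp⟩, ?_⟩
        rw [hN k (by lia) _ _ hv.1 hv.2.1]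
        simp)
  refine ⟨e, fun v z y hz hy => (he v).trans (congrArg (Subquotient.mk _) (Subtype.ext ?_))⟩
  rw [hy]
  exact congrArg (Subquotient.mk _) (Subtype.ext hz.symm)

end Presentation

end FilteredComplex

namespace LinkDiagram

variable {D : LinkDiagram}

/-! ### Coefficients of powers of `u` -/

variable (D) in
/-- The coefficient of `u ^ n` as a linear map. -/
noncomputable def coeffLinear (n : ℕ) :
    (D.EnhancedState → Polynomial (ZMod 2)) →ₗ[ZMod 2] (D.EnhancedState → ZMod 2) :=
  LinearMap.compLeft (Polynomial.lcoeff (ZMod 2) n) D.EnhancedState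

lemma coeffVec_sub (n : ℕ) (v w : D.EnhancedState → Polynomial (ZMod 2)) :
    coeffVec n (v - w) = coeffVec n v - coeffVec n w := map_sub (D.coeffLinear n) v w

lemma coeffVec_add (n : ℕ) (v w : D.EnhancedState → Polynomial (ZMod 2)) :
    coeffVec n (v + w) = coeffVec n v + coeffVec n w := map_add (D.coeffLinear n) v w

/-- For `k ≤ 0` both sides hold for every `v`. -/
lemma mem_uFil_iff {k : ℤ} {v : D.EnhancedState → Polynomial (ZMod 2)} :
    v ∈ D.uFil k ↔ ∀ p : ℕ, (p : ℤ) < k → coeffVec p v = 0 := by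
  have h1 : v ∈ D.uFil k ↔ ∀ S, Polynomial.X ^ k.toNat ∣ v S := by
    constructor
    · rintro ⟨w, rfl⟩ S
      exact ⟨w S, rfl⟩
    · intro h
      choose w hw using h
      exact ⟨w, funext fun S => (hw S).symm⟩
  simp only [h1, Polynomial.X_pow_dvd_iff]
  constructor
  · intro h p hp
    exact funext fun S => h S p (by lia)
  · intro h S p hp
    exact congrFun (h p (by lia)) S

lemma uFil_eq_top {k : ℤ} (hk : k ≤ 0) : D.uFil k = ⊤ :=
  eq_top_iff.2 fun _ _ => mem_uFil_iff.2 fun p hp => by lia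

lemma coeffVec_uMultiple (n p : ℕ) (z : D.EnhancedState → ZMod 2) :
    coeffVec p (D.uMultiple n z) = if p = n then z else 0 := by
  ext S
  simp only [coeffVec, uMultiple, Int.toNat_natCast, Polynomial.coeff_X_pow_mul',
    Polynomial.coeff_C]
  split_ifs <;> first | rfl | lia

lemma uMultiple_mem_uFil (n : ℕ) (z : D.EnhancedState → ZMod 2) : D.uMultiple n z ∈ D.uFil n :=
  mem_uFil_iff.2 fun p hp => by rw [coeffVec_uMultiple, if_neg (by lia)]

lemma uMultiple_mem_bnChain {n : ℕ} {i j : ℤ} {z : D.EnhancedState → ZMod 2}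
    (hz : z ∈ D.khChain i (j + 2 * n)) : D.uMultiple n z ∈ D.bnChain i j := by
  rw [mem_bnChain_iff]
  intro p
  rw [coeffVec_uMultiple]
  split_ifs with h
  · rwa [h]
  · exact Submodule.zero_mem _

/-- The power of `u` in a term of an element of `C^{*,j}(D)` is determined by `j` and the enhanced
state, and there are finitely many enhanced states. -/
lemma exists_uFil_inf_bnChain (D : LinkDiagram) (j : ℤ) :
    ∃ N : ℤ, ∀ k ≥ N, ∀ i, ∀ v ∈ D.uFil k, v ∈ D.bnChain i j → v = 0 := by
  refine ⟨1 + ∑ S : D.EnhancedState, |qDeg S - j|, fun k hk i v hv hv' => ?_⟩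
  ext S p
  by_contra hne
  obtain ⟨-, hq⟩ := hv' S p hne
  have h1 : |qDeg S - j| ≤ ∑ S : D.EnhancedState, |qDeg S - j| :=
    Finset.single_le_sum (f := fun S : D.EnhancedState => |qDeg S - j|)
      (fun _ _ => abs_nonneg _) (Finset.mem_univ S)
  have h2 := le_abs_self (qDeg S - j)
  exact hne (congrFun (mem_uFil_iff.1 hv p (by lia)) S)

lemma coeffVec_barNatanD_of_mem {n : ℕ} {v : D.EnhancedState → Polynomial (ZMod 2)}
    (hv : v ∈ D.uFil n) : coeffVec n (D.barNatanD v) = D.khovanovD (coeffVec n v) := by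
  rcases n with _ | n
  · exact coeffVec_zero_barNatanD v
  · rw [coeffVec_succ_barNatanD, mem_uFil_iff.1 hv n (by lia), map_zero, add_zero]

lemma mem_uFil_succ_iff {n : ℕ} {v : D.EnhancedState → Polynomial (ZMod 2)} :
    v ∈ D.uFil (n + 1) ↔ v ∈ D.uFil n ∧ coeffVec n v = 0 := by
  simp only [mem_uFil_iff]
  constructor
  · exact fun h => ⟨fun p hp => h p (by lia), h n (by lia)⟩
  · rintro ⟨h1, h2⟩ p hp
    rcases lt_or_ge (p : ℤ) n with h | h
    · exact h1 p h
    · obtain rfl : p = n := by lia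
      exact h2

lemma barNatanD_mem_uFil {k : ℤ} {v : D.EnhancedState → Polynomial (ZMod 2)} (hv : v ∈ D.uFil k) :
    D.barNatanD v ∈ D.uFil k := (D.bnComplex 0).d_mem_fil k v hv

lemma mem_Z_iff {j r k l : ℤ} {v : D.EnhancedState → Polynomial (ZMod 2)} :
    v ∈ (D.bnComplex j).Z r k l ↔
      v ∈ D.uFil k ∧ v ∈ D.bnChain (k + l) j ∧ D.barNatanD v ∈ D.uFil (k + r) :=
  FilteredComplex.mem_Z

lemma mem_B_iff {j r k l : ℤ} {v : D.EnhancedState → Polynomial (ZMod 2)} :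
    v ∈ (D.bnComplex j).B r k l ↔ ∃ a b : D.EnhancedState → Polynomial (ZMod 2),
      (a ∈ D.uFil (k + 1) ∧ a ∈ D.bnChain (k + l) j ∧ D.barNatanD a ∈ D.uFil (k + r)) ∧
      (b ∈ D.uFil (k - r + 1) ∧ b ∈ D.bnChain (k + l - 1) j ∧ D.barNatanD b ∈ D.uFil k) ∧
      v = a + D.barNatanD b :=
  FilteredComplex.mem_B

/-! ### Leading coefficients -/

lemma coeffVec_mem_cocycles {j l i q : ℤ} {n : ℕ} (hi : i = n + l) (hq : q = j + 2 * n)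
    {v : D.EnhancedState → Polynomial (ZMod 2)} (hv : v ∈ (D.bnComplex j).Z 1 n l) :
    coeffVec n v ∈ cocycles D.khovanovD (fun i => D.khChain i q) i := by
  subst hi hq
  rw [mem_Z_iff] at hv
  refine ⟨?_, mem_bnChain_iff.1 hv.2.1 n⟩
  change D.khovanovD (coeffVec n v) = 0
  rw [← coeffVec_barNatanD_of_mem hv.1]
  exact (mem_uFil_succ_iff.1 hv.2.2).2

/-- The class of the leading coefficient: the coefficient of `u ^ n` in an element of `Z_1^{n,l}` is
a cocycle of the Khovanov complex. -/
noncomputable def leadingClass {j l i q : ℤ} {n : ℕ} (hi : i = n + l) (hq : q = j + 2 * n) :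
    (D.bnComplex j).Z 1 n l →ₗ[ZMod 2] D.Kh i q :=
  Subquotient.mk _ ∘ₗ (D.coeffLinear n).restrict fun _ => coeffVec_mem_cocycles hi hq

lemma leadingClass_apply {j l i q : ℤ} {n : ℕ} (hi : i = n + l) (hq : q = j + 2 * n)
    {v : D.EnhancedState → Polynomial (ZMod 2)} (hv : v ∈ (D.bnComplex j).Z 1 n l) :
    leadingClass hi hq ⟨v, hv⟩ = D.khClass ⟨coeffVec n v, coeffVec_mem_cocycles hi hq hv⟩ := rfl

lemma khClass_eq_zero_iff {i q : ℤ} (z : cocycles D.khovanovD (fun i => D.khChain i q) i) :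
    D.khClass z = 0 ↔ ∃ w ∈ D.khChain (i - 1) q, D.khovanovD w = z :=
  Subquotient.mk_eq_zero_iff _

lemma uMultiple_mem_Z_one {j l : ℤ} {n : ℕ} {z : D.EnhancedState → ZMod 2}
    (hz : z ∈ D.khChain (n + l) (j + 2 * n)) (hz' : D.khovanovD z = 0) :
    D.uMultiple n z ∈ (D.bnComplex j).Z 1 n l := by
  refine mem_Z_iff.2 ⟨uMultiple_mem_uFil n z, uMultiple_mem_bnChain hz, mem_uFil_succ_iff.2
    ⟨barNatanD_mem_uFil (uMultiple_mem_uFil n z), ?_⟩⟩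
  rw [coeffVec_barNatanD_of_mem (uMultiple_mem_uFil n z), coeffVec_uMultiple, if_pos rfl, hz']

lemma leadingClass_surjective {j l i q : ℤ} {n : ℕ} (hi : i = n + l) (hq : q = j + 2 * n) :
    Function.Surjective (leadingClass (D := D) hi hq) := by
  intro ξ
  obtain ⟨z, rfl⟩ := Subquotient.mk_surjective _ ξ
  subst hi hq
  refine ⟨⟨D.uMultiple n z, uMultiple_mem_Z_one z.2.2 z.2.1⟩, ?_⟩
  rw [leadingClass_apply]
  refine congrArg _ (Subtype.ext ?_)
  exact (coeffVec_uMultiple n n _).trans (if_pos rfl)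

/-- If the leading coefficient of `v` is `∂ w`, then subtracting `d (u ^ n w)` from `v` moves it to
the next step of the filtration. -/
lemma leadingClass_eq_zero_iff {j l i q : ℤ} {n : ℕ} (hi : i = n + l) (hq : q = j + 2 * n)
    {v : D.EnhancedState → Polynomial (ZMod 2)} (hv : v ∈ (D.bnComplex j).Z 1 n l) :
    leadingClass hi hq ⟨v, hv⟩ = 0 ↔ v ∈ (D.bnComplex j).B 1 n l := by
  subst hi hq
  rw [leadingClass_apply, khClass_eq_zero_iff, mem_B_iff]
  replace hv := mem_Z_iff.1 hv
  constructor
  · rintro ⟨w, hw, hwv⟩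
    have hwv' : D.khovanovD w = coeffVec n v := hwv
    have hu := uMultiple_mem_uFil n w
    have hc := uMultiple_mem_bnChain hw
    have hdc := barNatanD_mem hc
    rw [sub_add_cancel] at hdc
    have ha : v - D.barNatanD (D.uMultiple n w) ∈ D.uFil (n + 1) := by
      refine mem_uFil_succ_iff.2 ⟨Submodule.sub_mem _ hv.1 (barNatanD_mem_uFil hu), ?_⟩
      rw [coeffVec_sub, coeffVec_barNatanD_of_mem hu, coeffVec_uMultiple, if_pos rfl, hwv',
        sub_self]
    exact ⟨_, D.uMultiple n w, ⟨ha, Submodule.sub_mem _ hv.2.1 hdc, barNatanD_mem_uFil ha⟩,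
      ⟨by rwa [sub_add_cancel], hc, barNatanD_mem_uFil hu⟩, by abel⟩
  · rintro ⟨a, b, ha, hb, h⟩
    rw [sub_add_cancel] at hb
    refine ⟨coeffVec n b, mem_bnChain_iff.1 hb.2.1 n, ?_⟩
    change _ = coeffVec n v
    rw [h, coeffVec_add, (mem_uFil_succ_iff.1 ha.1).2, zero_add, coeffVec_barNatanD_of_mem hb.1]

lemma beta_mem_cocycles {i j i' j' : ℤ} (hi : i' = i + 1) (hj : j' = j + 2)
    {z : D.EnhancedState → ZMod 2} (hz : z ∈ cocycles D.khovanovD (fun i => D.khChain i j) i) :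
    D.beta z ∈ cocycles D.khovanovD (fun i => D.khChain i j') i' := by
  subst hi hj
  refine ⟨?_, beta_mem hz.2⟩
  change D.khovanovD (D.beta _) = 0
  rw [khovanovD_beta, show D.khovanovD _ = 0 from hz.1, map_zero]

lemma betaStar_khClass {i j i' j' : ℤ} (hi : i' = i + 1) (hj : j' = j + 2)
    (z : cocycles D.khovanovD (fun i => D.khChain i j) i)
    (y : cocycles D.khovanovD (fun i => D.khChain i j') i')
    (hy : (y : D.EnhancedState → ZMod 2) = D.beta z) :
    D.betaStar hi hj (D.khClass z) = D.khClass y :=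
  congrArg (Subquotient.mk _) (Subtype.ext hy.symm)

/-- Comparing coefficients of `u ^ (n + 1)` in `d v`, for `v` with leading term `u ^ n z`, gives
`β z` up to a coboundary. -/
lemma leadingClass_barNatanD {j l i q : ℤ} {n : ℕ} (hi : i = n + l) (hq : q = j + 2 * n)
    {i' q' : ℤ} (hi' : i' = (n + 1 : ℕ) + l) (hq' : q' = j + 2 * (n + 1 : ℕ))
    (hii : i' = i + 1) (hqq : q' = q + 2) {v : D.EnhancedState → Polynomial (ZMod 2)}
    (hv : v ∈ (D.bnComplex j).Z 1 n l) (hw : D.barNatanD v ∈ (D.bnComplex j).Z 1 (n + 1 : ℕ) l) :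
    leadingClass hi' hq' ⟨D.barNatanD v, hw⟩ =
      D.betaStar hii hqq (leadingClass hi hq ⟨v, hv⟩) := by
  have hv' := mem_Z_iff.1 hv
  have hz := coeffVec_mem_cocycles hi hq hv
  rw [leadingClass_apply, leadingClass_apply,
    betaStar_khClass hii hqq _ ⟨_, beta_mem_cocycles hii hqq hz⟩ rfl, ← sub_eq_zero, ← map_sub,
    khClass_eq_zero_iff]
  refine ⟨coeffVec (n + 1) v, ?_, ?_⟩
  · rw [hii, add_sub_cancel_right, hq', hi]
    exact mem_bnChain_iff.1 hv'.2.1 (n + 1)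
  · change _ = coeffVec (n + 1) (D.barNatanD v) - D.beta (coeffVec n v)
    rw [coeffVec_succ_barNatanD, add_sub_cancel_right]

lemma Z_two_le_Z_one (j k l : ℤ) : (D.bnComplex j).Z 2 k l ≤ (D.bnComplex j).Z 1 k l :=
  FilteredComplex.Z_succ_le _ 1 k l

/-- For `v` in `Z_2^{n,l}` the coefficient `∂ v_{n+1} + β v_n` of `u ^ (n + 1)` in `d v`
vanishes. -/
lemma leadingClass_mem_ker {j l i q : ℤ} {n : ℕ} (hi : i = n + l) (hq : q = j + 2 * n)
    {v : D.EnhancedState → Polynomial (ZMod 2)} (hv : v ∈ (D.bnComplex j).Z 2 n l) :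
    leadingClass hi hq ⟨v, Z_two_le_Z_one j n l hv⟩ ∈
      LinearMap.ker (D.betaStar (rfl : i + 1 = i + 1) (rfl : q + 2 = q + 2)) := by
  have hv' := mem_Z_iff.1 hv
  have hdd : D.barNatanD (D.barNatanD v) = 0 := D.barNatanD_barNatanD v
  have hd := barNatanD_mem hv'.2.1
  rw [show (n : ℤ) + 2 = (n + 1 : ℕ) + 1 by push_cast; ring] at hv'
  have hd1 := mem_uFil_succ_iff.1 hv'.2.2
  have hw : D.barNatanD v ∈ (D.bnComplex j).Z 1 (n + 1 : ℕ) l := by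
    refine mem_Z_iff.2 ⟨hd1.1, ?_, by rw [hdd]; exact Submodule.zero_mem _⟩
    rwa [show ((n + 1 : ℕ) : ℤ) + l = n + l + 1 by push_cast; ring]
  rw [LinearMap.mem_ker, ← leadingClass_barNatanD hi hq (by push_cast; lia) (by push_cast; lia)
    rfl rfl (Z_two_le_Z_one j n l hv) hw, leadingClass_apply, khClass_eq_zero_iff]
  exact ⟨0, Submodule.zero_mem _, (map_zero _).trans hd1.2.symm⟩

/-- The leading class of an element of `Z_2^{n,l}`, as an element of the kernel of `β_*`. -/
noncomputable def leadingClassKer {j l i q : ℤ} {n : ℕ} (hi : i = n + l) (hq : q = j + 2 * n) :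
    (D.bnComplex j).Z 2 n l →ₗ[ZMod 2]
      LinearMap.ker (D.betaStar (rfl : i + 1 = i + 1) (rfl : q + 2 = q + 2)) :=
  (leadingClass hi hq ∘ₗ Submodule.inclusion (Z_two_le_Z_one j n l)).codRestrict _
    fun v => leadingClass_mem_ker hi hq v.2

lemma coe_leadingClassKer {j l i q : ℤ} {n : ℕ} (hi : i = n + l) (hq : q = j + 2 * n)
    {v : D.EnhancedState → Polynomial (ZMod 2)} (hv : v ∈ (D.bnComplex j).Z 2 n l) :
    (leadingClassKer hi hq ⟨v, hv⟩ : D.Kh i q) = leadingClass hi hq ⟨v, Z_two_le_Z_one j n l hv⟩ :=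
  LinearMap.codRestrict_apply _ _ _

/-- If `β z = ∂ w` then `u ^ n z + u ^ (n + 1) w` lies in `Z_2`. -/
lemma exists_mem_Z_two {j l : ℤ} {n : ℕ} {z w : D.EnhancedState → ZMod 2}
    (hz : z ∈ D.khChain (n + l) (j + 2 * n)) (hz' : D.khovanovD z = 0)
    (hw : w ∈ D.khChain (n + l) (j + 2 * n + 2)) (hw' : D.khovanovD w = D.beta z) :
    ∃ v : D.EnhancedState → Polynomial (ZMod 2),
      v ∈ (D.bnComplex j).Z 2 n l ∧ coeffVec n v = z := by
  set v := D.uMultiple n z + D.uMultiple (n + 1 : ℕ) w with hv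
  have hcn : coeffVec n v = z := by
    rw [hv, coeffVec_add, coeffVec_uMultiple, coeffVec_uMultiple, if_pos rfl, if_neg (by lia),
      add_zero]
  have hcn' : coeffVec (n + 1) v = w := by
    rw [hv, coeffVec_add, coeffVec_uMultiple, coeffVec_uMultiple, if_neg (by lia), if_pos rfl,
      zero_add]
  have hu : v ∈ D.uFil n := by
    refine Submodule.add_mem _ (uMultiple_mem_uFil n z) ?_
    have := uMultiple_mem_uFil (n + 1) w
    push_cast at this ⊢
    exact (mem_uFil_succ_iff.1 this).1
  refine ⟨v, mem_Z_iff.2 ⟨hu, Submodule.add_mem _ (uMultiple_mem_bnChain hz)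
    (uMultiple_mem_bnChain ?_), ?_⟩, hcn⟩
  · rwa [show j + 2 * ((n + 1 : ℕ) : ℤ) = j + 2 * n + 2 by push_cast; ring]
  · rw [show (n : ℤ) + 2 = (n + 1 : ℕ) + 1 by push_cast; ring, mem_uFil_succ_iff, Nat.cast_succ,
      mem_uFil_succ_iff]
    refine ⟨⟨barNatanD_mem_uFil hu, ?_⟩, ?_⟩
    · rw [coeffVec_barNatanD_of_mem hu, hcn, hz']
    · rw [coeffVec_succ_barNatanD, hcn, hcn', hw']
      ext S
      exact CharTwo.add_self_eq_zero _

lemma leadingClassKer_surjective {j l i q : ℤ} {n : ℕ} (hi : i = n + l) (hq : q = j + 2 * n) :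
    Function.Surjective (leadingClassKer (D := D) hi hq) := by
  rintro ⟨ξ, hξ⟩
  obtain ⟨z, rfl⟩ := Subquotient.mk_surjective _ ξ
  subst hi hq
  rw [LinearMap.mem_ker, betaStar_khClass rfl rfl z ⟨_, beta_mem_cocycles rfl rfl z.2⟩ rfl,
    khClass_eq_zero_iff] at hξ
  obtain ⟨w, hw, hwz⟩ := hξ
  rw [add_sub_cancel_right] at hw
  obtain ⟨v, hv, hvz⟩ := exists_mem_Z_two z.2.2 z.2.1 hw hwz
  refine ⟨⟨v, hv⟩, Subtype.ext ?_⟩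
  refine (coe_leadingClassKer rfl rfl hv).trans ((leadingClass_apply rfl rfl _).trans ?_)
  exact congrArg D.khClass (Subtype.ext hvz)

/-- On the column `k = 0`, an element of `Z_2` lies in `B_2` if and only if it lies in `B_1`, because
`F^{-1} = F^0`. So nothing more is divided out in `E_2` than in `E_1`. -/
lemma leadingClassKer_eq_zero_iff {j l i q : ℤ} (hi : i = (0 : ℕ) + l) (hq : q = j + 2 * (0 : ℕ))
    {v : D.EnhancedState → Polynomial (ZMod 2)} (hv : v ∈ (D.bnComplex j).Z 2 (0 : ℕ) l) :
    leadingClassKer hi hq ⟨v, hv⟩ = 0 ↔ v ∈ (D.bnComplex j).B 2 (0 : ℕ) l := by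
  rw [← ZeroMemClass.coe_eq_zero, coe_leadingClassKer, leadingClass_eq_zero_iff, mem_B_iff,
    mem_B_iff]
  refine exists_congr fun a => exists_congr fun b => ?_
  rw [uFil_eq_top (k := ((0 : ℕ) : ℤ) - 1 + 1) (by simp),
    uFil_eq_top (k := ((0 : ℕ) : ℤ) - 2 + 1) (by simp)]
  constructor
  · rintro ⟨ha, hb, h⟩
    refine ⟨⟨ha.1, ha.2.1, ?_⟩, hb, h⟩
    have := congrArg D.barNatanD h
    rw [map_add, D.barNatanD_barNatanD, add_zero] at this
    rw [← this]
    exact (mem_Z_iff.1 hv).2.2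
  · rintro ⟨ha, hb, h⟩
    exact ⟨⟨ha.1, ha.2.1, barNatanD_mem_uFil ha.1⟩, hb, h⟩

/-- In positive filtration degree every class in the source of `β_*` is the leading class of an
element of `Z_1^{n,l}`, so the values of `β_*` are the values of `d_1`. -/
lemma leadingClassKer_mem_range_iff {j l i q : ℤ} {n : ℕ} (hi : i = (n + 1 : ℕ) + l)
    (hq : q = j + 2 * (n + 1 : ℕ)) {v : D.EnhancedState → Polynomial (ZMod 2)}
    (hv : v ∈ (D.bnComplex j).Z 2 (n + 1 : ℕ) l) (hii : i = i - 1 + 1) (hqq : q = q - 2 + 2) :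
    (leadingClassKer hi hq ⟨v, hv⟩ : D.Kh i q) ∈ LinearMap.range (D.betaStar hii hqq) ↔
      v ∈ (D.bnComplex j).B 2 (n + 1 : ℕ) l := by
  have hi₀ : i - 1 = n + l := by rw [hi]; push_cast; ring
  have hq₀ : q - 2 = j + 2 * n := by rw [hq]; push_cast; ring
  have hd : ∀ y ∈ (D.bnComplex j).Z 1 n l, D.barNatanD y ∈ (D.bnComplex j).Z 1 (n + 1 : ℕ) l :=
    fun y hy => (D.bnComplex j).d_mem_Z (Nat.cast_succ n).symm (by ring) hy
  have key : ∀ (y) (hy : y ∈ (D.bnComplex j).Z 1 n l),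
      D.betaStar hii hqq (leadingClass hi₀ hq₀ ⟨y, hy⟩) =
        leadingClass hi hq ⟨v, Z_two_le_Z_one j _ l hv⟩ ↔
      v - D.barNatanD y ∈ (D.bnComplex j).B 1 (n + 1 : ℕ) l := by
    intro y hy
    rw [← leadingClass_barNatanD hi₀ hq₀ hi hq hii hqq hy (hd y hy), eq_comm, ← sub_eq_zero,
      ← map_sub]
    exact leadingClass_eq_zero_iff hi hq
      (Submodule.sub_mem _ (Z_two_le_Z_one j _ l hv) (hd y hy))
  rw [coe_leadingClassKer]
  refine Iff.trans ?_ ((D.bnComplex j).mem_B_succ_iff (r := 1) (k₀ := n) (l₀ := l)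
    (Nat.cast_succ n).symm (by ring) hv).symm
  constructor
  · rintro ⟨ξ, hξ⟩
    obtain ⟨⟨y, hy⟩, rfl⟩ := leadingClass_surjective hi₀ hq₀ ξ
    exact ⟨y, hy, (key y hy).1 hξ⟩
  · rintro ⟨y, hy, h⟩
    exact ⟨_, (key y hy).2 h⟩

end LinkDiagram

namespace LinkDiagram

open CategoryTheory

variable {D : LinkDiagram} {j : ℤ}
  {E : CohomologicalSpectralSequence (ModuleCat.{0} (ZMod 2)) 0}

/-! ### The first two pages -/

/-- The identification of `E_1^{n,l}` with Khovanov homology, by leading coefficients. -/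
lemma exists_linearEquiv_kh (P : (D.bnComplex j).Presentation E) {n : ℕ} {l i q : ℤ}
    (hi : i = n + l) (hq : q = j + 2 * n) :
    ∃ e : (E.page 1 zero_le_one).X ((n : ℤ), l) ≃ₗ[ZMod 2] D.Kh i q,
      ∀ v, e (P.π 1 zero_le_one n l v) = leadingClass hi hq v :=
  exists_linearEquiv_of_ker_eq _ _ (P.π_surjective _ _ _ _) (leadingClass_surjective hi hq) (by
    ext v
    exact (P.π_eq_zero_iff zero_le_one v).trans (leadingClass_eq_zero_iff hi hq v.2).symm)

lemma exists_linearEquiv_ker_betaStar (P : (D.bnComplex j).Presentation E) {l i q : ℤ}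
    (hi : i = (0 : ℕ) + l) (hq : q = j + 2 * (0 : ℕ)) :
    ∃ e : (E.page 2 zero_le_two).X (((0 : ℕ) : ℤ), l) ≃ₗ[ZMod 2]
        LinearMap.ker (D.betaStar (rfl : i + 1 = i + 1) (rfl : q + 2 = q + 2)),
      ∀ v, e (P.π 2 zero_le_two (0 : ℕ) l v) = leadingClassKer hi hq v :=
  exists_linearEquiv_of_ker_eq _ _ (P.π_surjective _ _ _ _) (leadingClassKer_surjective hi hq) (by
    ext v
    exact (P.π_eq_zero_iff zero_le_two v).trans (leadingClassKer_eq_zero_iff hi hq v.2).symm)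

lemma exists_linearEquiv_KK (P : (D.bnComplex j).Presentation E) {n : ℕ} {l i q : ℤ}
    (hi : i = (n + 1 : ℕ) + l) (hq : q = j + 2 * (n + 1 : ℕ)) :
    ∃ e : (E.page 2 zero_le_two).X (((n + 1 : ℕ) : ℤ), l) ≃ₗ[ZMod 2] D.KK i q,
      ∀ v, e (P.π 2 zero_le_two (n + 1 : ℕ) l v) =
        Subquotient.mk _ (leadingClassKer hi hq v) :=
  exists_linearEquiv_of_ker_eq _ (Subquotient.mk _ ∘ₗ leadingClassKer hi hq)
    (P.π_surjective _ _ _ _)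
    ((Subquotient.mk_surjective _).comp (leadingClassKer_surjective hi hq)) (by
      ext v
      exact (P.π_eq_zero_iff zero_le_two v).trans
        ((Subquotient.mk_eq_zero_iff _).trans
          (leadingClassKer_mem_range_iff hi hq v.2 (by ring) (by ring))).symm)

variable (D j) in
lemma exists_linearEquiv_directSum_grH (i : ℤ) :
    Nonempty (D.BN i j ≃ₗ[ZMod 2] DirectSum ℤ fun k => (D.bnComplex j).grH k i) := by
  obtain ⟨N, hN⟩ := D.exists_uFil_inf_bnChain j
  exact nonempty_linearEquiv_directSum_gr (fun k => (D.bnComplex j).filH k i)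
    (FilteredComplex.filH_antitone i) (FilteredComplex.filH_eq_top (uFil_eq_top le_rfl) i)
    (FilteredComplex.filH_eq_bot (hN N le_rfl i))

end LinkDiagram

theorem theorem4p3 (D : LinkDiagram) (j : ℤ) :
    -- there is a cohomological spectral sequence `E`, which is the spectral sequence of the `u`-adic
    -- filtration of `C^{*,j}(D)`
    ∃ (E : CategoryTheory.CohomologicalSpectralSequence (ModuleCat.{0} (ZMod 2)) 0)
      (P : (D.bnComplex j).Presentation E),
      -- it converges to `BN^{*,j}`: the induced filtration of `BN^{*,j}` is finite,
      (∀ k ≤ 0, ∀ i, (D.bnComplex j).filH k i = ⊤) ∧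
      (∃ N : ℤ, ∀ k ≥ N, ∀ i, (D.bnComplex j).filH k i = ⊥) ∧
      -- from some page on all differentials vanish and the page is the associated graded group,
      (∃ R : ℤ, ∀ (r : ℤ) (hr : 0 ≤ r), R ≤ r →
        (∀ p q : ℤ × ℤ, (E.page r hr).d p q = 0) ∧
        ∀ k l : ℤ, ∃ e : (E.page r hr).X (k, l) ≃ₗ[ZMod 2] (D.bnComplex j).grH k (k + l),
          ∀ (v : (D.bnComplex j).Z r k l)
            (z : cocycles (D.bnComplex j).d (D.bnComplex j).deg (k + l))
            (y : (D.bnComplex j).filH k (k + l)),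
            (z : (D.bnComplex j).carrier) = v →
            (y : (D.bnComplex j).H (k + l)) = Subquotient.mk _ z →
            e (P.π r hr k l v) = Subquotient.mk _ y) ∧
      -- and `BN^{i,j}` is isomorphic to the direct sum of these groups over `k + l = i`
      (∀ i : ℤ, Nonempty
        (D.BN i j ≃ₗ[ZMod 2] DirectSum ℤ fun k => (D.bnComplex j).grH k i)) ∧
      -- the page `E_1`
      (∀ k l : ℤ, k < 0 → Subsingleton ((E.page 1 zero_le_one).X (k, l))) ∧
      ∃ e₁ : ∀ k l i q : ℤ, 0 ≤ k → i = k + l → q = j + 2 * k →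
          ((E.page 1 zero_le_one).X (k, l) ≃ₗ[ZMod 2] D.Kh i q),
        (∀ (k l i q : ℤ) (hk : 0 ≤ k) (hi : i = k + l) (hq : q = j + 2 * k)
          (v : (D.bnComplex j).Z 1 k l)
          (z : cocycles D.khovanovD (fun i => D.khChain i q) i),
          (v : (D.bnComplex j).carrier) = D.uMultiple k z →
          e₁ k l i q hk hi hq (P.π 1 zero_le_one k l v) = D.khClass z) ∧
        -- the differential `d_1` is `β_*`
        (∀ (k l i q : ℤ) (hk : 0 ≤ k) (hi : i = k + l) (hq : q = j + 2 * k)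
          (hk' : 0 ≤ k + 1) (hi' : i + 1 = k + 1 + l) (hq' : q + 2 = j + 2 * (k + 1))
          (ξ : (E.page 1 zero_le_one).X (k, l)),
          e₁ (k + 1) l (i + 1) (q + 2) hk' hi' hq'
              ((E.page 1 zero_le_one).d (k, l) (k + 1, l) ξ) =
            D.betaStar rfl rfl (e₁ k l i q hk hi hq ξ)) ∧
        -- the page `E_2`
        (∀ k l : ℤ, k < 0 → Subsingleton ((E.page 2 zero_le_two).X (k, l))) ∧
        (∀ (l : ℤ) (hl : l = 0 + l) (hj : j = j + 2 * 0),
          ∃ e₂ : (E.page 2 zero_le_two).X (0, l) ≃ₗ[ZMod 2]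
            LinearMap.ker (D.betaStar (rfl : l + 1 = l + 1) (rfl : j + 2 = j + 2)),
          ∀ (v : (D.bnComplex j).Z 1 0 l) (w : (D.bnComplex j).Z 2 0 l),
            (w : (D.bnComplex j).carrier) = v →
            (e₂ (P.π 2 zero_le_two 0 l w) : D.Kh l j) =
              e₁ 0 l l j le_rfl hl hj (P.π 1 zero_le_one 0 l v)) ∧
        ∀ (k l i q : ℤ) (hk : 0 < k) (hi : i = k + l) (hq : q = j + 2 * k),
          ∃ e₂ : (E.page 2 zero_le_two).X (k, l) ≃ₗ[ZMod 2] D.KK i q,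
            ∀ (v : (D.bnComplex j).Z 1 k l) (w : (D.bnComplex j).Z 2 k l)
              (y : LinearMap.ker (D.betaStar (rfl : i + 1 = i + 1) (rfl : q + 2 = q + 2))),
              (w : (D.bnComplex j).carrier) = v →
              e₁ k l i q hk.le hi hq (P.π 1 zero_le_one k l v) = (y : D.Kh i q) →
              e₂ (P.π 2 zero_le_two k l w) = Subquotient.mk _ y := by
  let P := (D.bnComplex j).presentation
  obtain ⟨N, hN⟩ := D.exists_uFil_inf_bnChain j
  have h0 : ∀ k ≤ 0, (D.bnComplex j).fil k = ⊤ := fun k hk => LinkDiagram.uFil_eq_top hk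
  -- The leading class is defined for a natural exponent, so `k ≥ 0` is replaced by `k.toNat`; the
  -- memberships for `k` and `k.toNat` are then both hypotheses.
  have hE : ∀ k l i q : ℤ, 0 ≤ k → ∀ (hi : i = k.toNat + l) (hq : q = j + 2 * k.toNat),
      ∃ e : ((D.bnComplex j).spectralSequence.page 1 zero_le_one).X (k, l) ≃ₗ[ZMod 2] D.Kh i q,
        ∀ (v : D.EnhancedState → Polynomial (ZMod 2)) (hv : v ∈ (D.bnComplex j).Z 1 k l)
          (hv' : v ∈ (D.bnComplex j).Z 1 k.toNat l),
          e (P.π 1 zero_le_one k l ⟨v, hv⟩) = LinkDiagram.leadingClass hi hq ⟨v, hv'⟩ := by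
    intro k l i q hk hi hq
    obtain ⟨n, rfl⟩ := Int.eq_ofNat_of_zero_le hk
    obtain ⟨e, he⟩ := LinkDiagram.exists_linearEquiv_kh P hi hq
    exact ⟨e, fun v hv _ => he ⟨v, hv⟩⟩
  choose e₁ he₁ using fun (k l i q : ℤ) (hk : 0 ≤ k) (hi : i = k + l) (hq : q = j + 2 * k) =>
    hE k l i q hk (by rwa [Int.toNat_of_nonneg hk]) (by rwa [Int.toNat_of_nonneg hk])
  refine ⟨_, P, fun k hk i => FilteredComplex.filH_eq_top (h0 k hk) i,
    ⟨N, fun k hk i => FilteredComplex.filH_eq_bot (hN k hk i)⟩,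
    ⟨N, fun r hr hR => ⟨P.page_d_eq_zero h0 hN hr hR, P.exists_linearEquiv_grH h0 hN hr hR⟩⟩,
    LinkDiagram.exists_linearEquiv_directSum_grH D j,
    fun k l hk => P.subsingleton_X _ (h0 _ (by lia)) l,
    e₁, ?_, ?_, fun k l hk => P.subsingleton_X _ (h0 _ (by lia)) l, ?_, ?_⟩
  · rintro k l i q hk hi hq ⟨v, hv⟩ z hvz
    obtain ⟨n, rfl⟩ := Int.eq_ofNat_of_zero_le hk
    refine (he₁ n l i q hk hi hq v hv hv).trans ((LinkDiagram.leadingClass_apply hi hq hv).trans ?_)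
    refine congrArg D.khClass (Subtype.ext ?_)
    obtain rfl : v = D.uMultiple n z := hvz
    exact (LinkDiagram.coeffVec_uMultiple n n _).trans (if_pos rfl)
  · intro k l i q hk hi hq hk' hi' hq' ξ
    obtain ⟨⟨v, hv⟩, rfl⟩ := P.π_surjective 1 zero_le_one k l ξ
    obtain ⟨n, rfl⟩ := Int.eq_ofNat_of_zero_le hk
    have hd := (D.bnComplex j).d_mem_Z (k' := (n : ℤ) + 1) (l' := l) rfl (by ring) hv
    rw [P.d_π_of_eq zero_le_one rfl (by ring) ⟨v, hv⟩ ⟨_, hd⟩ rfl, he₁ n l i q hk hi hq v hv hv]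
    exact (he₁ _ l _ _ hk' hi' hq' _ hd hd).trans
      (LinkDiagram.leadingClass_barNatanD hi hq hi' hq' rfl rfl hv hd)
  · intro l hl hj
    obtain ⟨e₂, he₂⟩ := LinkDiagram.exists_linearEquiv_ker_betaStar P hl hj
    refine ⟨e₂, ?_⟩
    rintro ⟨v, hv⟩ ⟨w, hw⟩ rfl
    rw [he₁ 0 l l j le_rfl hl hj w hv hv]
    exact (congrArg Subtype.val (he₂ ⟨w, hw⟩)).trans (LinkDiagram.coe_leadingClassKer hl hj hw)
  · intro k l i q hk hi hq
    obtain ⟨n, rfl⟩ : ∃ n : ℕ, k = (n + 1 : ℕ) := ⟨(k - 1).toNat, by lia⟩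
    obtain ⟨e₂, he₂⟩ := LinkDiagram.exists_linearEquiv_KK P hi hq
    refine ⟨e₂, ?_⟩
    rintro ⟨v, hv⟩ ⟨w, hw⟩ y rfl hy
    refine (he₂ ⟨w, hw⟩).trans (congrArg (Subquotient.mk _) (Subtype.ext ?_))
    rw [← hy, he₁ _ l i q hk.le hi hq w hv hv]
    exact LinkDiagram.coe_leadingClassKer hi hq hw
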